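/- Let $(\Omega,\mathcal F,\mathbb P)$ be a probability space, $M>0$, and let $X$ be a random variable with values in $[0,M]$ almost surely. For a random variable $Y$ that is nonnegative almost surely write $F_Y^{-1}(t)=\inf\{x\ge 0:\mathbb P(Y\le x)\ge t\}$, $t\in[0,1]$. Assume the following. (1) The distribution function $F_X$ is strictly increasing on $[0,M]$ and $F_X^{-1}$ is absolutely continuous on $[0,1]$. (2) $u:[0,\infty)\to[0,\infty)$ is strictly increasing, and is twice differentiable on $(0,\infty)$ with $u'$ strictly decreasing there. (3) $T:[0,1]\to[0,1]$ is a continuous, strictly increasing surjection, twice differentiable on $(0,1)$; for some $b\in(0,1)$ the derivative $T'$ is strictly decreasing on $(0,b)$ and strictly increasing on $(b,1)$; moreover $T'(0+)\in(1,+\infty]$ and $T'(1-)=+\infty$. Let $f(z)=\frac{1-T(z)}{1-z}$ for $z\in[0,1)$. Let $a\in(0,1)$ be the unique point such that $f$ is strictly decreasing on $[0,a]$ and strictly increasing on $[a,1)$, and let $c\in(a,1)$ be the unique point with $f(c)=1$. Let $W_0\in\mathbb R$, $\rho>-1$, $W=W_0-(1+\rho)E[X]$, assume $W-M\ge 0$,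 and for $\Delta>0$ put $W_\Delta=W+(1+\rho)\Delta$. With $A_g=-g''/g'$, assume further the following. (4) $A_u$ is non-increasing on $(0,\infty)$, and $A_T(z)>A_u(W-F_X^{-1}(z))\,(F_X^{-1})'(z)$ for every $z\in(0,a]$ at which $F_X^{-1}$ is differentiable. Let $\mathcal R$ be the set of functions $R$ on $[0,M]$ with $R(0)=0$ and $0\le R(x)-R(y)\le x-y$ for $0\le y\le x\le M$, and let $\mathbb G=\{F_{R(X)}^{-1}:R\in\mathcal R\}$, a set of functions on $[0,1]$. Consider the problem $$\max_{G\in\mathbb G}\ \int_0^1 u(W_\Delta-G(z))\,T'(z)\,dz\quad\text{subject to}\quad \int_0^1 G(z)\,dz\ge\Delta.\tag{$*$}$$ Let $l_\Delta$ be the unique zero in $(a,c]$ of $$h_\Delta(z)=\int_0^z\Big[\frac{u'(W_\Delta-F_X^{-1}(z))(1-T(z))}{1-z}-u'(W_\Delta-F_X^{-1}(t))T'(t)\Big]dt ,$$ and let $K_\Delta=\int_0^1\underline G(z)\,dz$, where $\underline G(z)=F_X^{-1}(z)$ for $0\le z<l_\Delta$ and $\underline G(z)=F_X^{-1}(l_\Delta)$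 for $l_\Delta\le z\le 1$. Suppose $0<\Delta<K_\Delta$. For $0\le z_2\le a\le z_1<1$ put $$G^*_{z_2,z_1}(z)=\begin{cases}0,&0\le z<z_2,\\ F_X^{-1}(z)-F_X^{-1}(z_2),&z_2\le z<z_1,\\ F_X^{-1}(z_1)-F_X^{-1}(z_2),&z_1\le z\le 1.\end{cases}$$ Then there exist $0\le z_2\le a\le z_1<1$ with $$\int_{z_2}^{z_1}\Big[\frac{u'(W_\Delta-F_X^{-1}(z_1)+F_X^{-1}(z_2))(1-T(z_1))}{1-z_1}-u'(W_\Delta-F_X^{-1}(t)+F_X^{-1}(z_2))T'(t)\Big]dt=0\quad\text{and}\quad\int_0^1G^*_{z_2,z_1}(z)\,dz=\Delta,$$ and for every such pair $(z_2,z_1)$ the function $G^*_{z_2,z_1}$ is the unique optimal solution of $(*)$. -/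

import Mathlib

open MeasureTheory Set Filter Topology

namespace RDUInsurance

noncomputable section

/-- The distribution function `x ↦ P(Y ≤ x)` of a random variable. -/
def distr {Ω : Type*} [MeasurableSpace Ω] (P : Measure Ω) (Y : Ω → ℝ) (x : ℝ) : ℝ :=
  P.real {ω | Y ω ≤ x}

/-- The quantile function `t ↦ inf {x ≥ 0 : P(Y ≤ x) ≥ t}` of a nonnegative random variable;
only its values on `[0,1]` matter. -/
def quantile {Ω : Type*} [MeasurableSpace Ω] (P : Measure Ω) (Y : Ω → ℝ) (t : ℝ) : ℝ :=
  sInf {x : ℝ | 0 ≤ x ∧ t ≤ distr P Y x}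

/-- A random loss supported in `[0,M]`, whose distribution function is strictly increasing on
`[0,M]` (atoms are allowed) and whose quantile function is absolutely continuous on `[0,1]`. -/
structure IsLoss {Ω : Type*} [MeasurableSpace Ω] (P : Measure Ω) (X : Ω → ℝ) (M : ℝ) : Prop where
  pos : 0 < M
  measurable : Measurable X
  support : ∀ᵐ ω ∂P, X ω ∈ Icc 0 M
  distr_strictMono : StrictMonoOn (distr P X) (Icc 0 M)
  quantile_ac : AbsolutelyContinuousOnInterval (quantile P X) 0 1

/-- A strictly concave utility `u : [0,∞) → [0,∞)`: strictly increasing and twice differentiable,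
with strictly decreasing derivative. Differentiability is only asked for on `(0,∞)`. -/
structure IsUtility (u : ℝ → ℝ) : Prop where
  nonneg : ∀ x, 0 ≤ x → 0 ≤ u x
  strictMono : StrictMonoOn u (Ici 0)
  differentiable : DifferentiableOn ℝ u (Ioi 0)
  differentiable_deriv : DifferentiableOn ℝ (deriv u) (Ioi 0)
  deriv_strictAnti : StrictAntiOn (deriv u) (Ioi 0)

/-- An inverse-S shaped probability weighting function. The limit `T'(0+)`, which may be `+∞`, is
taken in the extended reals. -/
structure IsWeighting (T : ℝ → ℝ) : Prop where
  continuous : ContinuousOn T (Icc 0 1)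
  strictMono : StrictMonoOn T (Icc 0 1)
  onto : T '' Icc 0 1 = Icc 0 1
  differentiable : DifferentiableOn ℝ T (Ioo 0 1)
  differentiable_deriv : DifferentiableOn ℝ (deriv T) (Ioo 0 1)
  inverseS : ∃ b ∈ Ioo (0 : ℝ) 1,
    StrictAntiOn (deriv T) (Ioo 0 b) ∧ StrictMonoOn (deriv T) (Ioo b 1)
  deriv_zero : ∃ L : EReal, 1 < L ∧ Tendsto (fun z : ℝ => ((deriv T z : ℝ) : EReal)) (𝓝[>] 0) (𝓝 L)
  deriv_one : Tendsto (deriv T) (𝓝[<] 1) atTop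

/-- The Arrow-Pratt measure of absolute risk aversion `A_f = -f''/f'`. -/
def arrowPratt (f : ℝ → ℝ) (x : ℝ) : ℝ := -(deriv (deriv f) x / deriv f x)

/-- The function `f(z) = (1 - T(z)) / (1 - z)` on `[0,1)`. -/
def tailSlope (T : ℝ → ℝ) (z : ℝ) : ℝ := (1 - T z) / (1 - z)

/-- The point `a`: the unique point of `(0,1)` such that `f` is strictly decreasing on `[0,a]`
and strictly increasing on `[a,1)`. -/
def pointA (T : ℝ → ℝ) : ℝ :=
  Classical.epsilon fun a : ℝ => a ∈ Ioo (0 : ℝ) 1 ∧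
    StrictAntiOn (tailSlope T) (Icc 0 a) ∧ StrictMonoOn (tailSlope T) (Ico a 1)

/-- The point `c`: the unique point of `(a,1)` with `f(c) = 1`, that is `T(c) = c`. -/
def pointC (T : ℝ → ℝ) : ℝ :=
  Classical.epsilon fun c : ℝ => c ∈ Ioo (pointA T) 1 ∧ tailSlope T c = 1

/-- The risk aversion assumption, with `W` the wealth net of the full-coverage premium and `q` the
quantile function of the loss: `A_u` is decreasing on `(0,∞)`, and
`A_T(z) > A_u(W - q(z)) q'(z)` at every `z ∈ (0,a]` at which `q` is differentiable. -/
structure RiskAversionCondition (u T q : ℝ → ℝ) (W : ℝ) : Prop where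
  antitone : AntitoneOn (arrowPratt u) (Ioi 0)
  lt : ∀ z ∈ Ioc 0 (pointA T), DifferentiableAt ℝ q z →
    arrowPratt u (W - q z) * deriv q z < arrowPratt T z

/-- The retention functions on `[0,M]`. -/
def retentions (M : ℝ) : Set (ℝ → ℝ) :=
  {R | R 0 = 0 ∧ ∀ y x, 0 ≤ y → y ≤ x → x ≤ M → 0 ≤ R x - R y ∧ R x - R y ≤ x - y}

/-- The quantile functions of the retained losses `R(X)`; membership concerns the values on `[0,1]`
only. -/
def retentionQuantiles {Ω : Type*} [MeasurableSpace Ω] (P : Measure Ω) (X : Ω → ℝ) (M : ℝ) :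
    Set (ℝ → ℝ) :=
  {G | ∃ R ∈ retentions M, EqOn G (quantile P (R ∘ X)) (Icc 0 1)}

/-- The constraint set of the quantile problem. -/
def feasibleSet {Ω : Type*} [MeasurableSpace Ω] (P : Measure Ω) (X : Ω → ℝ) (M Δ : ℝ) :
    Set (ℝ → ℝ) :=
  {G | G ∈ retentionQuantiles P X M ∧ Δ ≤ ∫ z in (0 : ℝ)..1, G z}

/-- The objective `∫₀¹ u(w - G(z)) T'(z) dz`. -/
def objective (u T : ℝ → ℝ) (w : ℝ) (G : ℝ → ℝ) : ℝ :=
  ∫ z in (0 : ℝ)..1, u (w - G z) * deriv T z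

/-- `G` maximizes the objective, with wealth level `w`, over the constraint set. -/
def IsOptimal {Ω : Type*} [MeasurableSpace Ω] (P : Measure Ω) (X : Ω → ℝ) (M : ℝ)
    (u T : ℝ → ℝ) (w Δ : ℝ) (G : ℝ → ℝ) : Prop :=
  G ∈ feasibleSet P X M Δ ∧ IsMaxOn (objective u T w) (feasibleSet P X M Δ) G

/-- The function `h_Δ`, with `w = W_Δ`. -/
def hFun (u T q : ℝ → ℝ) (w z : ℝ) : ℝ :=
  ∫ t in (0 : ℝ)..z,
    (deriv u (w - q z) * (1 - T z) / (1 - z) - deriv u (w - q t) * deriv T t)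

/-- The point `l_Δ`: the unique zero of `h_Δ` in `(a,c]`. -/
def pointL (u T q : ℝ → ℝ) (w : ℝ) : ℝ :=
  Classical.epsilon fun l : ℝ => l ∈ Ioc (pointA T) (pointC T) ∧ hFun u T q w l = 0

/-- The quantile of the deductible contract with level `l`. -/
def deductible (q : ℝ → ℝ) (l z : ℝ) : ℝ := if z < l then q z else q l

/-- The threshold `K_Δ`, with `w = W_Δ`. -/
def threshold (u T q : ℝ → ℝ) (w : ℝ) : ℝ :=
  ∫ z in (0 : ℝ)..1, deductible q (pointL u T q w) z

/-- The quantile of the threefold contract. -/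
def threefold (q : ℝ → ℝ) (z₂ z₁ z : ℝ) : ℝ :=
  if z < z₂ then 0 else if z < z₁ then q z - q z₂ else q z₁ - q z₂

/-- The requirements on the pair `(z₂, z₁)`, with `w = W_Δ`. -/
structure IsThreefoldPair (u T q : ℝ → ℝ) (w Δ z₂ z₁ : ℝ) : Prop where
  nonneg : 0 ≤ z₂
  le_a : z₂ ≤ pointA T
  a_le : pointA T ≤ z₁
  lt_one : z₁ < 1
  integral_eq : ∫ t in z₂..z₁,
    (deriv u (w - q z₁ + q z₂) * (1 - T z₁) / (1 - z₁)
      - deriv u (w - q t + q z₂) * deriv T t) = 0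
  mean_eq : ∫ z in (0 : ℝ)..1, threefold q z₂ z₁ z = Δ

end

end RDUInsurance

/-! Quantiles commute with retention functions (`IsLoss.quantile_comp`), so every admissible `G` is
`R ∘ q` on `[0,1]` with `q` the quantile of the loss: the increments of `G` lie between `0` and
those of `q`. The objective is concave in `G`, so a Lagrangian first order condition at the
threefold contract `g` suffices. With multiplier `λ = u'(w - q z₁ + q z₂) f(z₁)` it reads `∫ (u'(w -
g) T' - λ) (G - g) ≥ 0`.

The difference `G - g` increases on `[0,z₂]`, where `g` is flat, decreases on `[z₂,z₁]`, where `g`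
grows as fast as allowed, and increases on `[z₁,1]`. Integration by parts
(`mul_integral_le_integral_mul`) therefore reduces the condition to signs of tail integrals of `u'(w
- g) T' - λ` on the three pieces (`IsThreefoldPair.integral_excess`). To the right of `a` the signs
come from the monotonicity of `f`. To the left they come from `strictAntiOn_marginal`: by the risk
aversion condition, marginal utility times `T'` strictly decreases there, so the integrand changes
sign at most once. Strict concavity of `u` and `T' > 0` almost everywhere then give uniqueness.

For existence, fix `z₂` in `[0,a]`. The equation for `z₁` has a strictly increasing left side on
`[a,1)`, nonpositive at `a` and nonnegative at `c`; its root depends continuously on `z₂`. The mean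
of the resulting contract runs continuously from `K_Δ` at `z₂ = 0` to `0` at `z₂ = a`, hence takes
the value `Δ`. -/

namespace RDUInsurance

noncomputable section

/-! ### Quantiles of the loss and of retained losses -/

section Quantile

variable {Ω : Type*} [MeasurableSpace Ω] {P : Measure Ω} [IsProbabilityMeasure P]
  {X : Ω → ℝ} {M : ℝ}

theorem distr_eq_cdf (hX : Measurable X) (x : ℝ) :
    distr P X x = ProbabilityTheory.cdf (P.map X) x := by
  have := Measure.isProbabilityMeasure_map (μ := P) hX.aemeasurable
  rw [ProbabilityTheory.cdf_eq_real, map_measureReal_apply hX measurableSet_Iic]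
  rfl

theorem IsLoss.distr_M (hX : IsLoss P X M) : distr P X M = 1 := by
  unfold distr
  rw [measureReal_def, (prob_compl_eq_zero_iff₀ ?_).mp ?_]
  · simp
  · exact (measurableSet_le hX.measurable measurable_const).nullMeasurableSet
  · refine measure_mono_null ?_ (ae_iff.mp hX.support)
    intro ω hω hmem
    exact hω hmem.2

/-- Right continuity of the distribution function: the infimum defining the quantile is attained. -/
theorem IsLoss.le_distr_quantile (hX : IsLoss P X M) {t : ℝ} (ht : t ≤ 1) :
    t ≤ distr P X (quantile P X t) := by
  have hne : ({x : ℝ | 0 ≤ x ∧ t ≤ distr P X x}).Nonempty :=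
    ⟨M, hX.pos.le, by rw [hX.distr_M]; exact ht⟩
  have hbd : BddBelow {x : ℝ | 0 ≤ x ∧ t ≤ distr P X x} := ⟨0, fun x hx => hx.1⟩
  have hr := (ProbabilityTheory.cdf (P.map X)).right_continuous (quantile P X t)
  have h1 : Tendsto (ProbabilityTheory.cdf (P.map X)) (𝓝[>] (quantile P X t))
      (𝓝 (ProbabilityTheory.cdf (P.map X) (quantile P X t))) :=
    hr.mono_left (nhdsWithin_mono _ Ioi_subset_Ici_self)
  rw [distr_eq_cdf hX.measurable]
  refine ge_of_tendsto h1 ?_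
  filter_upwards [self_mem_nhdsWithin] with x hx
  obtain ⟨y, hy, hyx⟩ := exists_lt_of_csInf_lt hne hx
  have hy2 := hy.2
  rw [distr_eq_cdf hX.measurable] at hy2
  exact hy2.trans (ProbabilityTheory.monotone_cdf _ hyx.le)

theorem IsLoss.quantile_mem (hX : IsLoss P X M) {t : ℝ} (ht : t ≤ 1) :
    quantile P X t ∈ Icc 0 M := by
  have hM : M ∈ {x : ℝ | 0 ≤ x ∧ t ≤ distr P X x} :=
    ⟨hX.pos.le, by rw [hX.distr_M]; exact ht⟩
  exact ⟨le_csInf ⟨M, hM⟩ fun x hx => hx.1, csInf_le ⟨0, fun x hx => hx.1⟩ hM⟩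

theorem retentions.monotone {R : ℝ → ℝ} (hR : R ∈ retentions M) {x y : ℝ} (hy : 0 ≤ y)
    (hyx : y ≤ x) (hx : x ≤ M) : R y ≤ R x := sub_nonneg.mp (hR.2 y x hy hyx hx).1

theorem retentions.nonneg {R : ℝ → ℝ} (hR : R ∈ retentions M) {x : ℝ} (hx : x ∈ Icc 0 M) :
    0 ≤ R x := hR.1 ▸ retentions.monotone hR le_rfl hx.1 hx.2

theorem retentions.le_self {R : ℝ → ℝ} (hR : R ∈ retentions M) {x : ℝ} (hx : x ∈ Icc 0 M) :
    R x ≤ x := by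
  have := (hR.2 0 x le_rfl hx.1 hx.2).2
  rwa [hR.1, sub_zero, sub_zero] at this

/-- Quantile functions commute with retention functions. -/
theorem IsLoss.quantile_comp (hX : IsLoss P X M) {R : ℝ → ℝ} (hR : R ∈ retentions M)
    {t : ℝ} (ht : t ≤ 1) : quantile P (R ∘ X) t = R (quantile P X t) := by
  have hq := hX.quantile_mem ht
  have hle : ∀ x y : ℝ, (∀ v ∈ Icc 0 M, v ≤ x → R v ≤ y) → distr P X x ≤ distr P (R ∘ X) y := by
    intro x y h
    refine ENNReal.toReal_mono (measure_ne_top _ _) (measure_mono_ae ?_)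
    filter_upwards [hX.support] with ω hω hωx
    exact h _ hω hωx
  have hge : ∀ x y : ℝ, (∀ v ∈ Icc 0 M, R v ≤ y → v ≤ x) → distr P (R ∘ X) y ≤ distr P X x := by
    intro x y h
    refine ENNReal.toReal_mono (measure_ne_top _ _) (measure_mono_ae ?_)
    filter_upwards [hX.support] with ω hω hωx
    exact h _ hω hωx
  have hmem : R (quantile P X t) ∈ {x : ℝ | 0 ≤ x ∧ t ≤ distr P (R ∘ X) x} :=
    ⟨retentions.nonneg hR hq, (hX.le_distr_quantile ht).trans
      (hle _ _ fun v hv hvx => retentions.monotone hR hv.1 hvx hq.2)⟩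
  refine le_antisymm (csInf_le ⟨0, fun x hx => hx.1⟩ hmem) (le_csInf ⟨_, hmem⟩ ?_)
  rintro y ⟨hy0, hyt⟩
  by_contra! hlt
  have hRle := retentions.le_self hR hq
  set x₀ := quantile P X t with hx₀
  -- Going down from `x₀` by half of `R x₀ - y` lowers the 1-Lipschitz `R` by at most that half, so
  -- `R` stays above `y`. Hence `R(X) ≤ y` forces `X` below this smaller point, against the
  -- minimality of `x₀`.
  have hx1 : x₀ - (R x₀ - y) / 2 ∈ {x : ℝ | 0 ≤ x ∧ t ≤ distr P X x} := by
    refine ⟨by linarith, hyt.trans (hge _ _ fun v hv hvy => ?_)⟩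
    by_contra! hv'
    have h1 := retentions.monotone hR (y := x₀ - (R x₀ - y) / 2) (by linarith) hv'.le hv.2
    have h2 := (hR.2 (x₀ - (R x₀ - y) / 2) x₀ (by linarith) (by linarith) hq.2).2
    linarith
  have := csInf_le ⟨0, fun x hx => hx.1⟩ hx1
  change x₀ ≤ _ at this
  linarith

/-- The properties of the quantile function of a loss that the optimization problem uses. -/
structure IsLossQuantile (q : ℝ → ℝ) (M : ℝ) : Prop where
  ac : AbsolutelyContinuousOnInterval q 0 1
  mono : MonotoneOn q (Icc 0 1)
  zero : q 0 = 0
  le : ∀ t ∈ Icc (0 : ℝ) 1, q t ≤ M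

theorem IsLoss.isLossQuantile (hX : IsLoss P X M) : IsLossQuantile (quantile P X) M where
  ac := hX.quantile_ac
  mono := fun s _ t ht hst =>
    csInf_le_csInf ⟨0, fun x hx => hx.1⟩
      ⟨M, hX.pos.le, by rw [hX.distr_M]; exact ht.2⟩ fun x hx => ⟨hx.1, hst.trans hx.2⟩
  zero := le_antisymm (csInf_le ⟨0, fun x hx => hx.1⟩ ⟨le_rfl, measureReal_nonneg⟩)
    (hX.quantile_mem zero_le_one).1
  le := fun t ht => (hX.quantile_mem ht.2).2

theorem IsLossQuantile.continuousOn {q : ℝ → ℝ} (hq : IsLossQuantile q M) :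
    ContinuousOn q (Icc 0 1) := by
  simpa using hq.ac.continuousOn

theorem IsLossQuantile.nonneg {q : ℝ → ℝ} (hq : IsLossQuantile q M) {t : ℝ}
    (ht : t ∈ Icc (0 : ℝ) 1) : 0 ≤ q t :=
  hq.zero ▸ hq.mono (left_mem_Icc.mpr zero_le_one) ht ht.1

/-- Removes the probability space: afterwards only the fixed function `q` and the retention `R`
matter. -/
theorem IsLoss.mem_retentionQuantiles_iff (hX : IsLoss P X M) {G : ℝ → ℝ} :
    G ∈ retentionQuantiles P X M ↔
      ∃ R ∈ retentions M, EqOn G (fun t => R (quantile P X t)) (Icc 0 1) := by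
  refine exists_congr fun R => and_congr_right fun hR => ?_
  have : EqOn (quantile P (R ∘ X)) (fun t => R (quantile P X t)) (Icc 0 1) :=
    fun t ht => hX.quantile_comp hR ht.2
  exact ⟨fun h => h.trans this, fun h => h.trans this.symm⟩

end Quantile

/-! ### Shape of the weighting function and the points `a` and `c` -/

section Weighting

variable {T : ℝ → ℝ}

theorem IsWeighting.mapsTo (hT : IsWeighting T) {z : ℝ} (hz : z ∈ Icc (0 : ℝ) 1) :
    T z ∈ Icc (0 : ℝ) 1 := hT.onto ▸ mem_image_of_mem T hz

theorem IsWeighting.zero (hT : IsWeighting T) : T 0 = 0 := by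
  have h0 : (0 : ℝ) ∈ T '' Icc 0 1 := by rw [hT.onto]; simp
  obtain ⟨z, hz, hz0⟩ := h0
  refine le_antisymm ?_ (hT.mapsTo (by simp)).1
  calc T 0 ≤ T z := hT.strictMono.monotoneOn (by simp) hz hz.1
    _ = 0 := hz0

theorem IsWeighting.one (hT : IsWeighting T) : T 1 = 1 := by
  have h0 : (1 : ℝ) ∈ T '' Icc 0 1 := by rw [hT.onto]; simp
  obtain ⟨z, hz, hz0⟩ := h0
  refine le_antisymm (hT.mapsTo (by simp)).2 ?_
  calc 1 = T z := hz0.symm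
    _ ≤ T 1 := hT.strictMono.monotoneOn hz (by simp) hz.2

theorem IsWeighting.hasDerivAt (hT : IsWeighting T) {z : ℝ} (hz : z ∈ Ioo (0 : ℝ) 1) :
    HasDerivAt T (deriv T z) z :=
  (hT.differentiable.differentiableAt (isOpen_Ioo.mem_nhds hz)).hasDerivAt

theorem IsWeighting.continuousOn_deriv (hT : IsWeighting T) :
    ContinuousOn (deriv T) (Ioo 0 1) := hT.differentiable_deriv.continuousOn

theorem IsWeighting.intervalIntegrable_deriv (hT : IsWeighting T) {s t : ℝ}
    (hs : s ∈ Icc (0 : ℝ) 1) (ht : t ∈ Icc (0 : ℝ) 1) :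
    IntervalIntegrable (deriv T) volume s t :=
  (hT.strictMono.monotoneOn.mono (uIcc_subset_Icc hs ht)).intervalIntegrable_deriv

theorem IsWeighting.integral_deriv (hT : IsWeighting T) {s t : ℝ} (hs : 0 ≤ s) (hst : s ≤ t)
    (ht : t ≤ 1) : ∫ z in s..t, deriv T z = T t - T s :=
  intervalIntegral.integral_eq_sub_of_hasDerivAt_of_le hst
    (hT.continuous.mono (Icc_subset_Icc hs ht))
    (fun _ hz => hT.hasDerivAt ⟨hs.trans_lt hz.1, hz.2.trans_le ht⟩)
    (hT.intervalIntegrable_deriv ⟨hs, hst.trans ht⟩ ⟨hs.trans hst, ht⟩)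

theorem IsWeighting.deriv_nonneg (hT : IsWeighting T) {z : ℝ} (hz : z ∈ Ioo (0 : ℝ) 1) :
    0 ≤ deriv T z := by
  have h := (hT.strictMono.monotoneOn.derivWithin_nonneg (x := z))
  rwa [derivWithin_of_mem_nhds (Icc_mem_nhds hz.1 hz.2)] at h

/-- The derivative of `T` is positive except possibly at one point. -/
theorem IsWeighting.exists_forall_deriv_pos (hT : IsWeighting T) :
    ∃ b : ℝ, ∀ z ∈ Ioo (0 : ℝ) 1, z ≠ b → 0 < deriv T z := by
  obtain ⟨b, hb, hanti, hmono⟩ := hT.inverseS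
  refine ⟨b, fun z hz hzb => ?_⟩
  rcases lt_or_gt_of_ne hzb with h | h
  · have hm : (z + b) / 2 ∈ Ioo 0 b := ⟨by linarith [hz.1, hb.1], by linarith⟩
    exact (hT.deriv_nonneg ⟨hm.1, hm.2.trans hb.2⟩).trans_lt
      (hanti ⟨hz.1, h⟩ hm (by linarith))
  · have hm : (z + b) / 2 ∈ Ioo b 1 := ⟨by linarith, by linarith [hz.2, hb.2]⟩
    exact (hT.deriv_nonneg ⟨hb.1.trans hm.1, hm.2⟩).trans_lt
      (hmono hm ⟨h, hz.2⟩ (by linarith))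

theorem IsWeighting.exists_deriv_mul_eq (hT : IsWeighting T) {s t : ℝ} (hs : 0 ≤ s)
    (hst : s < t) (ht : t ≤ 1) : ∃ ξ ∈ Ioo s t, T t - T s = deriv T ξ * (t - s) := by
  obtain ⟨ξ, hξ, h⟩ := exists_deriv_eq_slope T hst
    (hT.continuous.mono (Icc_subset_Icc hs ht))
    (hT.differentiable.mono (Ioo_subset_Ioo hs ht))
  exact ⟨ξ, hξ, by rw [h]; field_simp [(sub_pos.mpr hst).ne']⟩

theorem IsWeighting.hasDerivAt_tailSlope (hT : IsWeighting T) {z : ℝ} (hz : z ∈ Ioo (0 : ℝ) 1) :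
    HasDerivAt (tailSlope T) ((1 - T z - deriv T z * (1 - z)) / (1 - z) ^ 2) z := by
  have h1 : (1 - z) ≠ 0 := by linarith [hz.2]
  have h := ((hT.hasDerivAt hz).const_sub 1).div ((hasDerivAt_id z).const_sub 1) h1
  refine h.congr_deriv ?_
  simp only [id]
  ring

theorem IsWeighting.continuousOn_tailSlope (hT : IsWeighting T) :
    ContinuousOn (tailSlope T) (Ico 0 1) :=
  ((continuousOn_const.sub hT.continuous).mono Ico_subset_Icc_self).div
    (continuousOn_const.sub continuousOn_id) fun z hz => by
      have := hz.2
      exact (sub_pos.mpr this).ne'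

theorem IsWeighting.tailSlope_zero (hT : IsWeighting T) : tailSlope T 0 = 1 := by
  simp [tailSlope, hT.zero]

theorem tailSlope_mul {z : ℝ} (hz : z < 1) : tailSlope T z * (1 - z) = 1 - T z :=
  div_mul_cancel₀ _ (by linarith)

/-- Existence of the minimum point of `tailSlope T`, with its position relative to the shape
of `T`. -/
theorem IsWeighting.exists_pointA (hT : IsWeighting T) :
    ∃ a ∈ Ioo (0 : ℝ) 1, StrictAntiOn (tailSlope T) (Icc 0 a) ∧
      StrictMonoOn (tailSlope T) (Ico a 1) ∧ deriv T a = tailSlope T a ∧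
      StrictAntiOn (deriv T) (Ioc 0 a) := by
  obtain ⟨b, hb, hanti, hmono⟩ := hT.inverseS
  obtain ⟨L, hL, hLim⟩ := hT.deriv_zero
  -- Numerator of the derivative of `tailSlope T`. It is negative near `0`, strictly increasing on
  -- `(0,b)` and positive on `[b,1)`, so it changes sign exactly once, before `b`.
  set φ : ℝ → ℝ := fun z => 1 - T z - deriv T z * (1 - z) with hφ
  have hφmono : StrictMonoOn φ (Ioo 0 b) := by
    intro z hz z' hz' hlt
    obtain ⟨ξ, hξ, h⟩ := hT.exists_deriv_mul_eq hz.1.le hlt (hz'.2.trans hb.2).le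
    have h1 : deriv T ξ < deriv T z := hanti hz ⟨hz.1.trans hξ.1, hξ.2.trans hz'.2⟩ hξ.1
    have h2 : deriv T z' < deriv T z := hanti hz hz' hlt
    have h3 : 0 < 1 - z' := by linarith [hz'.2, hb.2]
    simp only [hφ]
    nlinarith [mul_pos (sub_pos.mpr h2) h3, mul_pos (sub_pos.mpr h1) (sub_pos.mpr hlt)]
  have hlt_b : ∀ ξ ∈ Ioo b 1, deriv T b < deriv T ξ := by
    intro ξ hξ
    have hm : (b + ξ) / 2 ∈ Ioo b 1 := ⟨by linarith [hξ.1], by linarith [hξ.1, hξ.2]⟩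
    refine lt_of_le_of_lt ?_ (hmono hm hξ (by linarith [hξ.1]))
    have hc : Tendsto (deriv T) (𝓝[>] b) (𝓝 (deriv T b)) :=
      (hT.continuousOn_deriv.continuousAt (isOpen_Ioo.mem_nhds hb)).mono_left inf_le_left
    refine le_of_tendsto hc ?_
    filter_upwards [Ioo_mem_nhdsGT hm.1] with z hz
    exact (hmono ⟨hz.1, hz.2.trans hm.2⟩ hm hz.2).le
  have hφpos : ∀ z ∈ Ico b 1, 0 < φ z := by
    intro z hz
    obtain ⟨ξ, hξ, h⟩ := hT.exists_deriv_mul_eq (hb.1.le.trans hz.1) hz.2 le_rfl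
    have h1 : deriv T z < deriv T ξ := by
      rcases hz.1.eq_or_lt with rfl | h'
      · exact hlt_b ξ hξ
      · exact hmono ⟨h', hz.2⟩ ⟨h'.trans hξ.1, hξ.2⟩ hξ.1
    rw [hT.one] at h
    simp only [hφ]
    nlinarith [mul_pos (sub_pos.mpr h1) (sub_pos.mpr hz.2)]
  -- The mean value theorem gives `T z > z T'(z)` near `0`, hence `φ z < 1 - T'(z)`, and `T'(0+) >
  -- 1` makes this negative.
  obtain ⟨z₀, hz₀, hφz₀⟩ : ∃ z₀ ∈ Ioo 0 b, φ z₀ < 0 := by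
    have h1 := hLim.eventually (lt_mem_nhds hL)
    obtain ⟨z, hz1, hz⟩ := (h1.and (Ioo_mem_nhdsGT hb.1)).exists
    have hz1' : 1 < deriv T z := by exact_mod_cast hz1
    refine ⟨z, hz, ?_⟩
    obtain ⟨ξ, hξ, h⟩ := hT.exists_deriv_mul_eq le_rfl hz.1 (hz.2.trans hb.2).le
    have h2 : deriv T z < deriv T ξ := hanti ⟨hξ.1, hξ.2.trans hz.2⟩ hz hξ.2
    rw [hT.zero] at h
    simp only [hφ]
    nlinarith [mul_pos (sub_pos.mpr h2) hz.1]
  have hφcont : ContinuousOn φ (Ioo 0 1) :=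
    (continuousOn_const.sub (hT.continuous.mono Ioo_subset_Icc_self)).sub
      (hT.continuousOn_deriv.mul (continuousOn_const.sub continuousOn_id))
  obtain ⟨a, ha, hφa⟩ : (0 : ℝ) ∈ φ '' Icc z₀ b :=
    intermediate_value_Icc hz₀.2.le
      (hφcont.mono fun z hz => ⟨hz₀.1.trans_le hz.1, hz.2.trans_lt hb.2⟩)
      ⟨hφz₀.le, (hφpos b ⟨le_rfl, hb.2⟩).le⟩
  have hab : a < b := by
    refine lt_of_le_of_ne ha.2 ?_
    rintro rfl
    exact (hφpos a ⟨le_rfl, hb.2⟩).ne' hφa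
  have ha0 : 0 < a := hz₀.1.trans_le ha.1
  have ha1 : a < 1 := hab.trans hb.2
  refine ⟨a, ⟨ha0, ha1⟩, ?_, ?_, ?_, hanti.mono fun z hz => ⟨hz.1, hz.2.trans_lt hab⟩⟩
  · refine strictAntiOn_of_deriv_neg (convex_Icc 0 a)
      (hT.continuousOn_tailSlope.mono fun z hz => ⟨hz.1, hz.2.trans_lt ha1⟩) fun z hz => ?_
    rw [interior_Icc] at hz
    rw [(hT.hasDerivAt_tailSlope ⟨hz.1, hz.2.trans ha1⟩).deriv]
    refine div_neg_of_neg_of_pos ?_ (pow_pos (by linarith [hz.2]) 2)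
    rw [← hφa]
    exact hφmono ⟨hz.1, hz.2.trans hab⟩ ⟨ha0, hab⟩ hz.2
  · refine strictMonoOn_of_deriv_pos (convex_Ico a 1)
      (hT.continuousOn_tailSlope.mono fun z hz => ⟨ha0.le.trans hz.1, hz.2⟩) fun z hz => ?_
    rw [interior_Ico] at hz
    rw [(hT.hasDerivAt_tailSlope ⟨ha0.trans hz.1, hz.2⟩).deriv]
    refine div_pos ?_ (pow_pos (by linarith [hz.2]) 2)
    rcases lt_or_ge z b with h | h
    · rw [← hφa]
      exact hφmono ⟨ha0, hab⟩ ⟨ha0.trans hz.1, h⟩ hz.1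
    · exact hφpos z ⟨h, hz.2⟩
  · rw [tailSlope, eq_div_iff (by linarith)]
    simp only [hφ] at hφa
    linarith

theorem IsWeighting.pointA_spec (hT : IsWeighting T) :
    pointA T ∈ Ioo (0 : ℝ) 1 ∧ StrictAntiOn (tailSlope T) (Icc 0 (pointA T)) ∧
      StrictMonoOn (tailSlope T) (Ico (pointA T) 1) := by
  obtain ⟨a, ha, h1, h2, -⟩ := hT.exists_pointA
  exact Classical.epsilon_spec (p := fun a : ℝ => a ∈ Ioo (0 : ℝ) 1 ∧
    StrictAntiOn (tailSlope T) (Icc 0 a) ∧ StrictMonoOn (tailSlope T) (Ico a 1)) ⟨a, ha, h1, h2⟩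

/-- Otherwise `f` would both strictly decrease and strictly increase on `[a, a']`. Applied in both
directions, this identifies the chosen `pointA T` with the constructed critical point. -/
theorem pointA_unique {f : ℝ → ℝ} {a a' : ℝ} (ha : 0 < a) (ha' : a' < 1)
    (hanti : StrictAntiOn f (Icc 0 a')) (hmono : StrictMonoOn f (Ico a 1)) : a' ≤ a := by
  by_contra! h
  exact lt_asymm (hanti ⟨ha.le, h.le⟩ ⟨(ha.trans h).le, le_rfl⟩ h)
    (hmono ⟨le_rfl, h.trans ha'⟩ ⟨h.le, ha'⟩ h)

theorem IsWeighting.pointA_mem (hT : IsWeighting T) : pointA T ∈ Ioo (0 : ℝ) 1 :=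
  hT.pointA_spec.1

theorem IsWeighting.deriv_pointA (hT : IsWeighting T) :
    deriv T (pointA T) = tailSlope T (pointA T) ∧
      StrictAntiOn (deriv T) (Ioc 0 (pointA T)) := by
  obtain ⟨a, ha, h1, h2, h3, h4⟩ := hT.exists_pointA
  obtain ⟨ha', h1', h2'⟩ := hT.pointA_spec
  have : pointA T = a := le_antisymm (pointA_unique ha.1 ha'.2 h1' h2)
    (pointA_unique ha'.1 ha.2 h1 h2')
  rw [this]
  exact ⟨h3, h4⟩

theorem IsWeighting.tailSlope_pos (hT : IsWeighting T) {z : ℝ} (hz : z ∈ Ico (0 : ℝ) 1) :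
    0 < tailSlope T z := by
  refine div_pos ?_ (by linarith [hz.2])
  have := hT.strictMono ⟨hz.1, hz.2.le⟩ (right_mem_Icc.mpr zero_le_one) hz.2
  rw [hT.one] at this
  linarith

theorem IsWeighting.deriv_pos_of_le_pointA (hT : IsWeighting T) {z : ℝ}
    (hz : z ∈ Ioc 0 (pointA T)) : 0 < deriv T z := by
  have ha := hT.pointA_mem
  have hpos : 0 < deriv T (pointA T) := by
    rw [hT.deriv_pointA.1]
    exact hT.tailSlope_pos ⟨ha.1.le, ha.2⟩
  exact hpos.trans_le (hT.deriv_pointA.2.antitoneOn hz ⟨ha.1, le_rfl⟩ hz.2)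

/-- With `f = tailSlope T`, the increment is `f(s)(1 - s) - f(t)(1 - t)`, and `f(s) < f(t)` to the
right of `a`. -/
theorem IsWeighting.sub_lt_tailSlope_mul (hT : IsWeighting T) {s t : ℝ} (hs : pointA T ≤ s)
    (hst : s < t) (ht : t < 1) : T t - T s < tailSlope T t * (t - s) := by
  have h := hT.pointA_spec.2.2 ⟨hs, hst.trans ht⟩ ⟨hs.trans hst.le, ht⟩ hst
  have h1 := tailSlope_mul (T := T) (hst.trans ht)
  have h2 := tailSlope_mul (T := T) ht
  nlinarith [mul_pos (sub_pos.mpr h) (sub_pos.mpr (hst.trans ht))]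

theorem IsWeighting.pointC_spec (hT : IsWeighting T) :
    pointC T ∈ Ioo (pointA T) 1 ∧ tailSlope T (pointC T) = 1 := by
  obtain ⟨ha, hanti, hmono⟩ := hT.pointA_spec
  refine Classical.epsilon_spec (p := fun c : ℝ => c ∈ Ioo (pointA T) 1 ∧ tailSlope T c = 1) ?_
  have hfa : tailSlope T (pointA T) < 1 := by
    rw [← hT.tailSlope_zero]
    exact hanti ⟨le_rfl, ha.1.le⟩ ⟨ha.1.le, le_rfl⟩ ha.1
  obtain ⟨b, hb, -, hTm⟩ := hT.inverseS
  -- Since `T'(1-) = +∞` and `T'` increases beyond `b`, the slope of the chord from `y` to `1`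
  -- exceeds `1` for `y` near `1`.
  obtain ⟨d, hd, hfd⟩ : ∃ d ∈ Ioo (pointA T) 1, 1 < tailSlope T d := by
    obtain ⟨y, hy1, hy⟩ := ((tendsto_atTop.mp hT.deriv_one 1).and
      (Ioo_mem_nhdsLT (max_lt ha.2 hb.2))).exists
    have hya : pointA T < y := (le_max_left _ _).trans_lt hy.1
    have hyb : b < y := (le_max_right _ _).trans_lt hy.1
    refine ⟨y, ⟨hya, hy.2⟩, ?_⟩
    obtain ⟨ξ, hξ, h⟩ := hT.exists_deriv_mul_eq (ha.1.trans hya).le hy.2 le_rfl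
    rw [tailSlope, ← hT.one, h, hT.one, mul_div_assoc, div_self (by linarith [hy.2]), mul_one]
    exact hy1.trans_lt (hTm ⟨hyb, hy.2⟩ ⟨hyb.trans hξ.1, hξ.2⟩ hξ.1)
  obtain ⟨c, hc, hfc⟩ := intermediate_value_Icc hd.1.le
    (hT.continuousOn_tailSlope.mono fun z hz => ⟨ha.1.le.trans hz.1, hz.2.trans_lt hd.2⟩)
    ⟨hfa.le, hfd.le⟩
  refine ⟨c, ⟨lt_of_le_of_ne hc.1 ?_, hc.2.trans_lt hd.2⟩, hfc⟩
  rintro rfl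
  exact hfa.ne hfc

theorem IsWeighting.pointC_fixed (hT : IsWeighting T) : T (pointC T) = pointC T := by
  have h := tailSlope_mul (T := T) hT.pointC_spec.1.2
  rw [hT.pointC_spec.2] at h
  linarith

theorem IsWeighting.le_self (hT : IsWeighting T) {z : ℝ} (hz : z ∈ Icc 0 (pointA T)) :
    z ≤ T z := by
  obtain ⟨ha, hanti, -⟩ := hT.pointA_spec
  have h := hanti.antitoneOn ⟨le_rfl, ha.1.le⟩ hz hz.1
  rw [hT.tailSlope_zero] at h
  have h1 := tailSlope_mul (T := T) (hz.2.trans_lt ha.2)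
  nlinarith [hz.2, ha.2]

end Weighting

/-! ### Marginal utility and the risk aversion condition -/

section Utility

variable {u T q : ℝ → ℝ} {M W w : ℝ}

theorem IsUtility.deriv_pos (hu : IsUtility u) {x : ℝ} (hx : 0 < x) : 0 < deriv u x := by
  have h := hu.strictMono.monotoneOn.derivWithin_nonneg (x := x + 1)
  rw [derivWithin_of_mem_nhds (Ici_mem_nhds (by linarith))] at h
  exact h.trans_lt (hu.deriv_strictAnti hx (by simp only [mem_Ioi]; linarith) (by linarith))

theorem IsUtility.hasDerivAt (hu : IsUtility u) {x : ℝ} (hx : 0 < x) :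
    HasDerivAt u (deriv u x) x :=
  (hu.differentiable.differentiableAt (Ioi_mem_nhds hx)).hasDerivAt

theorem IsUtility.continuousOn_deriv (hu : IsUtility u) : ContinuousOn (deriv u) (Ioi 0) :=
  hu.differentiable_deriv.continuousOn

theorem IsUtility.arrowPratt_nonneg (hu : IsUtility u) {x : ℝ} (hx : 0 < x) :
    0 ≤ arrowPratt u x := by
  have h := hu.deriv_strictAnti.antitoneOn.derivWithin_nonpos (x := x)
  rw [derivWithin_of_mem_nhds (Ioi_mem_nhds hx)] at h
  exact neg_nonneg.mpr (div_nonpos_of_nonpos_of_nonneg h (hu.deriv_pos hx).le)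

theorem hasDerivAt_log_deriv {f : ℝ → ℝ} {x : ℝ} (hf : DifferentiableAt ℝ (deriv f) x)
    (hx : 0 < deriv f x) :
    HasDerivAt (fun y => Real.log (deriv f y)) (-arrowPratt f x) x := by
  rw [arrowPratt, neg_neg]
  exact hf.hasDerivAt.log hx.ne'

/-- The derivative of `log u'` is `-A_u`, and the non-increasing `A_u` is largest at the left end.
This is what lets absolute continuity pass from `q` to `log u'(κ - q)`. -/
theorem IsUtility.lipschitzOnWith_log_deriv (hu : IsUtility u)
    (hA : AntitoneOn (arrowPratt u) (Ioi 0)) {m n : ℝ} (hm : 0 < m) :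
    LipschitzOnWith (arrowPratt u m).toNNReal (fun x => Real.log (deriv u x)) (Icc m n) := by
  refine (convex_Icc m n).lipschitzOnWith_of_nnnorm_hasDerivWithin_le
    (f' := fun x => -arrowPratt u x) (fun x hx => ?_) fun x hx => ?_
  · have hx0 : 0 < x := hm.trans_le hx.1
    exact (hasDerivAt_log_deriv (hu.differentiable_deriv.differentiableAt (Ioi_mem_nhds hx0))
      (hu.deriv_pos hx0)).hasDerivWithinAt
  · have hx0 : 0 < x := hm.trans_le hx.1
    rw [nnnorm_neg, ← NNReal.coe_le_coe, coe_nnnorm, Real.norm_eq_abs,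
      abs_of_nonneg (hu.arrowPratt_nonneg hx0), Real.coe_toNNReal _ (hu.arrowPratt_nonneg hm)]
    exact hA hm hx0 hx.1

/-- A Lipschitz function of an absolutely continuous function is absolutely continuous. -/
theorem comp_absolutelyContinuousOnInterval {K : NNReal} {f g : ℝ → ℝ} {s : Set ℝ} {a b : ℝ}
    (hg : LipschitzOnWith K g s) (hf : AbsolutelyContinuousOnInterval f a b)
    (hfs : MapsTo f (uIcc a b) s) :
    AbsolutelyContinuousOnInterval (fun x => g (f x)) a b := by
  unfold AbsolutelyContinuousOnInterval at hf ⊢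
  have h := hf.const_mul (K : ℝ)
  rw [mul_zero] at h
  refine squeeze_zero' (Eventually.of_forall fun E => Finset.sum_nonneg fun i _ => dist_nonneg)
    ?_ h
  filter_upwards [mem_inf_of_right (mem_principal_self _)] with E hE
  rw [Finset.mul_sum]
  refine Finset.sum_le_sum fun i hi => ?_
  have hi' := hE.1 i hi
  exact hg.dist_le_mul _ (hfs hi'.1) _ (hfs hi'.2)

theorem IsLossQuantile.deriv_nonneg (hq : IsLossQuantile q M) {t : ℝ} (ht : t ∈ Ioo (0 : ℝ) 1) :
    0 ≤ deriv q t := by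
  have h := hq.mono.derivWithin_nonneg (x := t)
  rwa [derivWithin_of_mem_nhds (Icc_mem_nhds ht.1 ht.2)] at h

theorem IsLossQuantile.ac_sub (hq : IsLossQuantile q M) (κ : ℝ) {s t : ℝ}
    (hs : s ∈ Icc (0 : ℝ) 1) (ht : t ∈ Icc (0 : ℝ) 1) :
    AbsolutelyContinuousOnInterval (fun τ => κ - q τ) s t := by
  have h : LipschitzOnWith 1 (fun x : ℝ => κ - x) univ :=
    LipschitzOnWith.of_dist_le_mul fun x _ y _ => by
      rw [NNReal.coe_one, one_mul, Real.dist_eq, Real.dist_eq, sub_sub_sub_cancel_left,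
        abs_sub_comm]
  refine comp_absolutelyContinuousOnInterval h (hq.ac.mono ?_) (mapsTo_univ _ _)
  rw [uIcc_of_le (zero_le_one' ℝ)]
  exact uIcc_subset_Icc hs ht

/-- Under the risk aversion condition, marginal utility weighted by `T'` is strictly decreasing
up to `pointA T`. -/
theorem strictAntiOn_marginal (hu : IsUtility u) (hT : IsWeighting T) (hq : IsLossQuantile q M)
    (hAP : RiskAversionCondition u T q W) (hWM : M ≤ W) (hw : W < w) {κ : ℝ}
    (hκ : 0 ≤ κ) :
    StrictAntiOn (fun t => deriv u (w - q t + κ) * deriv T t) (Ioc 0 (pointA T)) := by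
  intro s hs t ht hst
  have ha := hT.pointA_mem
  have hs1 : s ∈ Icc (0 : ℝ) 1 := ⟨hs.1.le, hs.2.trans ha.2.le⟩
  have ht1 : t ∈ Icc (0 : ℝ) 1 := ⟨ht.1.le, ht.2.trans ha.2.le⟩
  have hsub : Icc s t ⊆ Icc 0 1 := Icc_subset_Icc hs1.1 ht1.2
  have hsuba : Icc s t ⊆ Ioc 0 (pointA T) := fun τ hτ => ⟨hs.1.trans_le hτ.1, hτ.2.trans ht.2⟩
  have hlow : ∀ τ ∈ Icc (0 : ℝ) 1, w - M ≤ w + κ - q τ := fun τ hτ => by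
    linarith [hq.le τ hτ]
  have hwM : 0 < w - M := by linarith
  have hpos : ∀ τ ∈ Icc (0 : ℝ) 1, 0 < w - q τ + κ := fun τ hτ => by
    linarith [hlow τ hτ]
  -- In logarithms the claim is that `L` grows by less than `ℓ` from `s` to `t`. The risk aversion
  -- condition compares their derivatives almost everywhere.
  set L : ℝ → ℝ := fun τ => Real.log (deriv u (w + κ - q τ)) with hL
  set ℓ : ℝ → ℝ := fun τ => -Real.log (deriv T τ) with hℓ
  have hLac : AbsolutelyContinuousOnInterval L s t := by
    refine comp_absolutelyContinuousOnInterval (g := fun x => Real.log (deriv u x))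
      (hu.lipschitzOnWith_log_deriv hAP.antitone (n := w + κ) hwM)
      (hq.ac_sub (w + κ) hs1 ht1) ?_
    rw [uIcc_of_le hst.le]
    exact fun τ hτ => ⟨hlow τ (hsub hτ), by linarith [hq.nonneg (hsub hτ)]⟩
  have hℓmono : MonotoneOn ℓ (uIcc s t) := by
    rw [uIcc_of_le hst.le]
    intro x hx y hy hxy
    exact neg_le_neg (Real.log_le_log (hT.deriv_pos_of_le_pointA (hsuba hy))
      (hT.deriv_pointA.2.antitoneOn (hsuba hx) (hsuba hy) hxy))
  have hlt : ∀ᵐ τ, τ ∈ Ioo s t → deriv L τ < deriv ℓ τ := by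
    filter_upwards [hq.ac.ae_differentiableAt] with τ hdiff hτ
    have hτ1 : τ ∈ Ioo (0 : ℝ) 1 := ⟨hs.1.trans hτ.1, hτ.2.trans_le ht1.2⟩
    have hτ1' : τ ∈ Icc (0 : ℝ) 1 := Ioo_subset_Icc_self hτ1
    have hτa : τ ∈ Ioc 0 (pointA T) := hsuba (Ioo_subset_Icc_self hτ)
    have hqd : DifferentiableAt ℝ q τ := hdiff (by rwa [uIcc_of_le (zero_le_one' ℝ)])
    have hx0 : 0 < w + κ - q τ := by linarith [hpos τ hτ1']
    have hdL : deriv L τ = arrowPratt u (w + κ - q τ) * deriv q τ := by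
      have h1 := hasDerivAt_log_deriv
        (hu.differentiable_deriv.differentiableAt (Ioi_mem_nhds hx0)) (hu.deriv_pos hx0)
      have h2 := h1.comp τ (hqd.hasDerivAt.const_sub (w + κ))
      rw [show L = (fun y => Real.log (deriv u y)) ∘ fun τ => w + κ - q τ from rfl, h2.deriv]
      ring
    have hdℓ : deriv ℓ τ = arrowPratt T τ := by
      have h1 := (hasDerivAt_log_deriv
        (hT.differentiable_deriv.differentiableAt (isOpen_Ioo.mem_nhds hτ1))
        (hT.deriv_pos_of_le_pointA hτa)).neg
      rw [neg_neg] at h1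
      exact h1.deriv
    rw [hdL, hdℓ]
    refine lt_of_le_of_lt ?_ (hAP.lt τ hτa hqd)
    -- `A_u` is controlled only on `(0,∞)`. If `W - q τ ≤ 0`, then `M ≤ W` makes `q` maximal at `τ`,
    -- so its derivative vanishes there.
    rcases lt_or_ge 0 (W - q τ) with h | h
    · exact mul_le_mul_of_nonneg_right (hAP.antitone h hx0 (by linarith))
        (hq.deriv_nonneg hτ1)
    · have hmax : IsLocalMax q τ := by
        filter_upwards [Icc_mem_nhds hτ1.1 hτ1.2] with y hy
        linarith [hq.le y hy]
      rw [hmax.deriv_eq_zero, mul_zero, mul_zero]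
  have hint : ∫ τ in s..t, deriv L τ < ∫ τ in s..t, deriv ℓ τ := by
    have hlt' : ∀ᵐ τ ∂volume.restrict (Ioc s t), deriv L τ < deriv ℓ τ := by
      rw [ae_restrict_congr_set Ioo_ae_eq_Ioc.symm, ae_restrict_iff' measurableSet_Ioo]
      exact hlt
    refine intervalIntegral.integral_lt_integral_of_ae_le_of_measure_setOfPred_lt_ne_zero hst.le
      hLac.intervalIntegrable_deriv hℓmono.intervalIntegrable_deriv
      (hlt'.mono fun τ h => h.le) ?_
    rw [measure_congr (eventuallyEq_univ.mpr hlt')]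
    simp [hst]
  rw [hLac.integral_deriv_eq_sub] at hint
  -- Absolute continuity of `ℓ` is not needed: the derivative of a monotone function integrates to
  -- at most its increment, the direction wanted. For `L` equality is needed, hence its absolute
  -- continuity.
  have hle : ∫ τ in s..t, deriv ℓ τ ≤ ℓ t - ℓ s := by
    have h := hℓmono.intervalIntegral_deriv_mem_uIcc
    rw [uIcc_of_le (sub_nonneg.mpr (hℓmono left_mem_uIcc right_mem_uIcc hst.le))] at h
    exact h.2
  have hus := hu.deriv_pos (hpos s hs1)
  have hut := hu.deriv_pos (hpos t ht1)
  have hTs := hT.deriv_pos_of_le_pointA hs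
  have hTt := hT.deriv_pos_of_le_pointA ht
  have hfin := hint.trans_le hle
  simp only [hL, hℓ] at hfin
  rw [add_sub_right_comm, add_sub_right_comm] at hfin
  refine (Real.log_lt_log_iff (mul_pos hut hTt) (mul_pos hus hTs)).mp ?_
  rw [Real.log_mul hut.ne' hTt.ne', Real.log_mul hus.ne' hTs.ne']
  linarith

end Utility

/-! ### First order conditions at the threefold contract -/

section Optimality

variable {u T q : ℝ → ℝ} {M W w Δ z₂ z₁ : ℝ}

theorem retentions.lipschitzOnWith {R : ℝ → ℝ} (hR : R ∈ retentions M) :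
    LipschitzOnWith 1 R (Icc 0 M) := by
  refine LipschitzOnWith.of_dist_le_mul fun x hx y hy => ?_
  rw [NNReal.coe_one, one_mul, Real.dist_eq, Real.dist_eq]
  rcases le_total x y with h | h
  · have := hR.2 x y hx.1 h hy.2
    rw [abs_sub_comm, abs_sub_comm x y, abs_of_nonneg this.1, abs_of_nonneg (sub_nonneg.mpr h)]
    exact this.2
  · have := hR.2 y x hy.1 h hx.2
    rw [abs_of_nonneg this.1, abs_of_nonneg (sub_nonneg.mpr h)]
    exact this.2

theorem IsLossQuantile.mem_Icc (hq : IsLossQuantile q M) {t : ℝ} (ht : t ∈ Icc (0 : ℝ) 1) :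
    q t ∈ Icc 0 M := ⟨hq.nonneg ht, hq.le t ht⟩

theorem IsLossQuantile.ac_comp (hq : IsLossQuantile q M) {R : ℝ → ℝ} (hR : R ∈ retentions M) :
    AbsolutelyContinuousOnInterval (fun t => R (q t)) 0 1 := by
  refine comp_absolutelyContinuousOnInterval (retentions.lipschitzOnWith hR) hq.ac ?_
  rw [uIcc_of_le (zero_le_one' ℝ)]
  exact fun t ht => hq.mem_Icc ht

/-- The retention function of the threefold contract. -/
def layer (m n x : ℝ) : ℝ := min (max x m) n - m

theorem layer_mem_retentions {m n : ℝ} (hm : 0 ≤ m) (hmn : m ≤ n) : layer m n ∈ retentions M := by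
  refine ⟨?_, fun y x _ hyx _ => ?_⟩
  · simp [layer, hm, hmn]
  · unfold layer
    rcases max_cases x m with ⟨h1, h1'⟩ | ⟨h1, h1'⟩ <;>
    rcases max_cases y m with ⟨h2, h2'⟩ | ⟨h2, h2'⟩ <;> rw [h1, h2] <;>
    constructor <;>
    simp only [min_def] <;> split_ifs <;> linarith

theorem threefold_eq_layer (hq : IsLossQuantile q M) (h2 : 0 ≤ z₂) (h21 : z₂ ≤ z₁) (h1 : z₁ ≤ 1) :
    EqOn (threefold q z₂ z₁) (fun t => layer (q z₂) (q z₁) (q t)) (Icc 0 1) := by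
  intro t ht
  have hz2 : z₂ ∈ Icc (0 : ℝ) 1 := ⟨h2, h21.trans h1⟩
  have hz1 : z₁ ∈ Icc (0 : ℝ) 1 := ⟨h2.trans h21, h1⟩
  have hq21 := hq.mono hz2 hz1 h21
  simp only [threefold, layer]
  split_ifs with ha hb
  · rw [max_eq_right (hq.mono ht hz2 ha.le), min_eq_left hq21, sub_self]
  · rw [max_eq_left (hq.mono hz2 ht (not_lt.mp ha)), min_eq_left (hq.mono ht hz1 hb.le)]
  · rw [max_eq_left (hq.mono hz2 ht (not_lt.mp ha)), min_eq_right (hq.mono hz1 ht (not_lt.mp hb))]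

/-- The pieces agree at `z₂` and `z₁`, so each of the three formulas holds up to and including its
end points. -/
theorem threefold_of_le {t : ℝ} (ht : t ≤ z₂) (h21 : z₂ ≤ z₁) :
    threefold q z₂ z₁ t = 0 := by
  unfold threefold
  split_ifs with ha hb
  · rfl
  · rw [le_antisymm ht (not_lt.mp ha), sub_self]
  · have : z₁ = z₂ := le_antisymm ((not_lt.mp hb).trans ht) h21
    rw [this, sub_self]

theorem threefold_of_mem {t : ℝ} (ht : t ∈ Icc z₂ z₁) :
    threefold q z₂ z₁ t = q t - q z₂ := by
  unfold threefold
  rw [if_neg (not_lt.mpr ht.1)]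
  split_ifs with hb
  · rfl
  · rw [le_antisymm ht.2 (not_lt.mp hb)]

theorem threefold_of_ge {t : ℝ} (ht : z₁ ≤ t) (h21 : z₂ ≤ z₁) :
    threefold q z₂ z₁ t = q z₁ - q z₂ := by
  unfold threefold
  rw [if_neg (not_lt.mpr (h21.trans ht)), if_neg (not_lt.mpr ht)]

/-- A monotone absolutely continuous weight keeps the sign of tail integrals. -/
theorem mul_integral_le_integral_mul {n D : ℝ → ℝ} {α β : ℝ} (hαβ : α ≤ β)
    (hn : IntervalIntegrable n volume α β) (hD : AbsolutelyContinuousOnInterval D α β)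
    (hDm : MonotoneOn D (Icc α β)) (htail : ∀ t ∈ Icc α β, 0 ≤ ∫ s in t..β, n s) :
    D α * ∫ t in α..β, n t ≤ ∫ t in α..β, n t * D t := by
  -- Based at `β`, this primitive is minus the tail integral: it is nonpositive and kills the
  -- boundary term at `β` in the integration by parts.
  set F : ℝ → ℝ := fun t => ∫ s in β..t, n s with hF
  have hFac : AbsolutelyContinuousOnInterval F α β :=
    hn.absolutelyContinuousOnInterval_intervalIntegral right_mem_uIcc
  have hibp := hD.integral_mul_deriv_eq_deriv_mul hFac
  have h1 : ∫ t in α..β, D t * deriv F t = ∫ t in α..β, n t * D t := by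
    refine intervalIntegral.integral_congr_ae ?_
    filter_upwards [hn.ae_hasDerivAt_integral] with t ht htm
    rw [(ht (uIoc_subset_uIcc htm) β right_mem_uIcc).deriv, mul_comm]
  have h2 : 0 ≤ ∫ t in α..β, -(deriv D t * F t) := by
    refine (intervalIntegral.integral_zero (a := α) (b := β)).symm.le.trans
      (intervalIntegral.integral_mono_on_of_le_Ioo hαβ intervalIntegrable_const
        (hD.intervalIntegrable_deriv.mul_continuousOn hFac.continuousOn).neg fun t ht => ?_)
    have hd := hDm.derivWithin_nonneg (x := t)
    rw [derivWithin_of_mem_nhds (Icc_mem_nhds ht.1 ht.2)] at hd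
    have hFt : F t ≤ 0 := by
      rw [hF]
      simp only
      rw [intervalIntegral.integral_symm]
      exact neg_nonpos.mpr (htail t (Ioo_subset_Icc_self ht))
    nlinarith
  rw [intervalIntegral.integral_neg] at h2
  rw [h1] at hibp
  have h3 : F β = 0 := intervalIntegral.integral_same
  have h4 : F α = -∫ t in α..β, n t := intervalIntegral.integral_symm _ _
  rw [hibp, h3, h4]
  linarith

/-- Mean value theorem and strict decrease of `u'`; the strictness is the source of uniqueness. -/
theorem IsUtility.lt_tangent (hu : IsUtility u) {x y : ℝ} (hx : 0 < x) (hy : 0 < y)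
    (hxy : y ≠ x) : u y < u x + deriv u x * (y - x) := by
  have hc : ∀ {s t : ℝ}, 0 < s → ContinuousOn u (Icc s t) := fun hs τ hτ =>
    (hu.hasDerivAt (hs.trans_le hτ.1)).continuousAt.continuousWithinAt
  have hd : ∀ {s t : ℝ}, 0 < s → DifferentiableOn ℝ u (Ioo s t) := fun hs =>
    hu.differentiable.mono fun τ hτ => hs.trans hτ.1
  rcases lt_or_gt_of_ne hxy with h | h
  · obtain ⟨ξ, hξ, he⟩ := exists_deriv_eq_slope u h (hc hy) (hd hy)
    have h1 : deriv u x < deriv u ξ := hu.deriv_strictAnti (hy.trans hξ.1) hx hξ.2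
    rw [he, lt_div_iff₀ (sub_pos.mpr h)] at h1
    linarith
  · obtain ⟨ξ, hξ, he⟩ := exists_deriv_eq_slope u h (hc hx) (hd hx)
    have h1 : deriv u ξ < deriv u x := hu.deriv_strictAnti hx (hx.trans hξ.1) hξ.1
    rw [he, div_lt_iff₀ (sub_pos.mpr h)] at h1
    linarith

theorem IsWeighting.integral_const_mul_deriv_sub (hT : IsWeighting T) (c l : ℝ) {s t : ℝ}
    (hs : 0 ≤ s) (hst : s ≤ t) (ht : t ≤ 1) :
    ∫ z in s..t, (c * deriv T z - l) = c * (T t - T s) - l * (t - s) := by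
  rw [intervalIntegral.integral_sub
      ((hT.intervalIntegrable_deriv ⟨hs, hst.trans ht⟩ ⟨hs.trans hst, ht⟩).const_mul c)
      intervalIntegrable_const, intervalIntegral.integral_const_mul,
    hT.integral_deriv hs hst ht, intervalIntegral.integral_const, smul_eq_mul, mul_comm l]

/-- Weighted marginal utility along a retention quantile is integrable. -/
theorem intervalIntegrable_marginal (hu : IsUtility u) (hT : IsWeighting T) {G : ℝ → ℝ}
    (hG : ContinuousOn G (Icc 0 1)) (hGw : ∀ t ∈ Icc (0 : ℝ) 1, G t < w) {s t : ℝ}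
    (hs : s ∈ Icc (0 : ℝ) 1) (ht : t ∈ Icc (0 : ℝ) 1) :
    IntervalIntegrable (fun z => deriv u (w - G z) * deriv T z) volume s t := by
  refine (hT.intervalIntegrable_deriv hs ht).continuousOn_mul ?_
  refine ContinuousOn.mono ?_ (uIcc_subset_Icc hs ht)
  exact hu.continuousOn_deriv.comp (continuousOn_const.sub hG) fun z hz =>
    sub_pos.mpr (hGw z hz)

/-- The Lagrange multiplier of the mean constraint at the threefold contract. -/
def multiplier (u T q : ℝ → ℝ) (w z₂ z₁ : ℝ) : ℝ :=
  deriv u (w - q z₁ + q z₂) * tailSlope T z₁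

/-- The derivative of the Lagrangian at the threefold contract, up to sign. -/
def excess (u T q : ℝ → ℝ) (w z₂ z₁ t : ℝ) : ℝ :=
  deriv u (w - threefold q z₂ z₁ t) * deriv T t - multiplier u T q w z₂ z₁

theorem continuousOn_threefold (hq : IsLossQuantile q M) (h2 : 0 ≤ z₂) (h21 : z₂ ≤ z₁)
    (h1 : z₁ ≤ 1) : ContinuousOn (threefold q z₂ z₁) (Icc 0 1) := by
  have hz2 : z₂ ∈ Icc (0 : ℝ) 1 := ⟨h2, h21.trans h1⟩
  have hz1 : z₁ ∈ Icc (0 : ℝ) 1 := ⟨h2.trans h21, h1⟩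
  have h := (hq.ac_comp (layer_mem_retentions (M := M) (hq.nonneg hz2)
    (hq.mono hz2 hz1 h21))).continuousOn
  rw [uIcc_of_le (zero_le_one' ℝ)] at h
  exact h.congr (threefold_eq_layer hq h2 h21 h1)

theorem threefold_le (hq : IsLossQuantile q M) (h2 : 0 ≤ z₂) (h21 : z₂ ≤ z₁) (h1 : z₁ ≤ 1)
    {t : ℝ} (ht : t ∈ Icc (0 : ℝ) 1) : threefold q z₂ z₁ t ≤ M := by
  have hz2 : z₂ ∈ Icc (0 : ℝ) 1 := ⟨h2, h21.trans h1⟩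
  have hz1 : z₁ ∈ Icc (0 : ℝ) 1 := ⟨h2.trans h21, h1⟩
  rw [threefold_eq_layer hq h2 h21 h1 ht]
  exact (retentions.le_self (layer_mem_retentions (hq.nonneg hz2) (hq.mono hz2 hz1 h21))
    (hq.mem_Icc ht)).trans (hq.le t ht)

theorem intervalIntegrable_excess (hu : IsUtility u) (hT : IsWeighting T)
    (hq : IsLossQuantile q M) (hMw : M < w) (h2 : 0 ≤ z₂) (h21 : z₂ ≤ z₁) (h1 : z₁ ≤ 1)
    {s t : ℝ} (hs : s ∈ Icc (0 : ℝ) 1) (ht : t ∈ Icc (0 : ℝ) 1) :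
    IntervalIntegrable (excess u T q w z₂ z₁) volume s t :=
  (intervalIntegrable_marginal hu hT (continuousOn_threefold hq h2 h21 h1)
    (fun _ hz => (threefold_le hq h2 h21 h1 hz).trans_lt hMw) hs ht).sub intervalIntegrable_const

/-- On this range `u'` along the contract is at most its value at `z₁`, as `q` increases. With that
constant in its place, `sub_lt_tailSlope_mul` concludes. -/
theorem integral_excess_nonpos (hu : IsUtility u) (hT : IsWeighting T)
    (hq : IsLossQuantile q M) (hMw : M < w) (h2 : 0 ≤ z₂) (h2a : z₂ ≤ pointA T)
    (h1 : z₁ < 1) {t : ℝ} (hat : pointA T ≤ t) (ht1 : t < z₁) :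
    ∫ s in t..z₁, excess u T q w z₂ z₁ s < 0 := by
  have h21 : z₂ ≤ z₁ := h2a.trans (hat.trans ht1.le)
  have hz1 : z₁ ∈ Icc (0 : ℝ) 1 := ⟨h2.trans h21, h1.le⟩
  have hz2 : z₂ ∈ Icc (0 : ℝ) 1 := ⟨h2, h21.trans h1.le⟩
  have ht0 : 0 ≤ t := hT.pointA_mem.1.le.trans hat
  have htm : t ∈ Icc (0 : ℝ) 1 := ⟨ht0, (ht1.trans h1).le⟩
  have hk : 0 < w - q z₁ + q z₂ := by linarith [hq.le z₁ hz1, hq.nonneg hz2]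
  have hle : ∫ s in t..z₁, excess u T q w z₂ z₁ s ≤
      ∫ s in t..z₁, (deriv u (w - q z₁ + q z₂) * deriv T s - multiplier u T q w z₂ z₁) := by
    refine intervalIntegral.integral_mono_on_of_le_Ioo ht1.le
      (intervalIntegrable_excess hu hT hq hMw h2 h21 h1.le htm hz1)
      (((hT.intervalIntegrable_deriv htm hz1).const_mul _).sub intervalIntegrable_const)
      fun s hs => ?_
    have hsm : s ∈ Icc (0 : ℝ) 1 := ⟨ht0.trans hs.1.le, (hs.2.trans h1).le⟩
    have hqs := hq.mono hsm hz1 hs.2.le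
    unfold excess
    rw [threefold_of_mem ⟨h2a.trans (hat.trans hs.1.le), hs.2.le⟩]
    refine sub_le_sub_right (mul_le_mul_of_nonneg_right ?_
      (hT.deriv_nonneg ⟨ht0.trans_lt hs.1, hs.2.trans h1⟩)) _
    exact hu.deriv_strictAnti.antitoneOn hk
      (by simp only [mem_Ioi]; linarith) (by linarith)
  refine hle.trans_lt ?_
  rw [hT.integral_const_mul_deriv_sub _ _ ht0 ht1.le h1.le]
  have hsl := hT.sub_lt_tailSlope_mul hat ht1 h1
  unfold multiplier
  nlinarith [mul_pos (hu.deriv_pos hk) (sub_pos.mpr hsl)]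

/-- The contract is constant beyond `z₁`, so the integral is explicit. It vanishes at `t = z₁`,
which explains the value of the multiplier. -/
theorem integral_excess_top (hT : IsWeighting T) (h2 : 0 ≤ z₂) (h21 : z₂ ≤ z₁)
    {t : ℝ} (ht1 : z₁ ≤ t) (ht : t < 1) :
    ∫ s in t..1, excess u T q w z₂ z₁ s =
      deriv u (w - q z₁ + q z₂) * (1 - t) * (tailSlope T t - tailSlope T z₁) := by
  have h : ∫ s in t..1, excess u T q w z₂ z₁ s =
      ∫ s in t..1, (deriv u (w - q z₁ + q z₂) * deriv T s - multiplier u T q w z₂ z₁) := by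
    refine intervalIntegral.integral_congr fun s hs => ?_
    rw [uIcc_of_le ht.le] at hs
    simp only [excess]
    rw [threefold_of_ge (ht1.trans hs.1) h21, sub_sub_eq_add_sub, add_sub_right_comm]
  rw [h, hT.integral_const_mul_deriv_sub _ _ (h2.trans (h21.trans ht1)) ht.le le_rfl, hT.one,
    ← tailSlope_mul ht, multiplier]
  ring

/-- The signs of the tail integrals of `excess` certify the first order conditions. -/
theorem IsThreefoldPair.integral_excess (hu : IsUtility u) (hT : IsWeighting T)
    (hq : IsLossQuantile q M) (hAP : RiskAversionCondition u T q W) (hMW : M ≤ W) (hWw : W < w)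
    (hΔ : 0 < Δ) (hz : IsThreefoldPair u T q w Δ z₂ z₁) :
    (∫ t in z₂..z₁, excess u T q w z₂ z₁ t = 0) ∧
    (∫ t in z₁..1, excess u T q w z₂ z₁ t = 0) ∧
    (∀ t ∈ Icc 0 z₂, 0 ≤ ∫ s in t..z₂, excess u T q w z₂ z₁ s) ∧
    (∀ t ∈ Icc z₂ z₁, ∫ s in t..z₁, excess u T q w z₂ z₁ s ≤ 0) ∧
    (∀ t ∈ Icc z₁ 1, 0 ≤ ∫ s in t..1, excess u T q w z₂ z₁ s) := by
  obtain ⟨h2, h2a, ha1, h1, hint, hmean⟩ := hz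
  obtain ⟨ha, -, hfmono⟩ := hT.pointA_spec
  have h21 : z₂ ≤ z₁ := h2a.trans ha1
  have hMw : M < w := hMW.trans_lt hWw
  have hz1 : z₁ ∈ Icc (0 : ℝ) 1 := ⟨h2.trans h21, h1.le⟩
  have hz2 : z₂ ∈ Icc (0 : ℝ) 1 := ⟨h2, h21.trans h1.le⟩
  have ham : pointA T ∈ Icc (0 : ℝ) 1 := Ioo_subset_Icc_self ha
  have hii : ∀ {s t : ℝ}, s ∈ Icc (0 : ℝ) 1 → t ∈ Icc (0 : ℝ) 1 →
      IntervalIntegrable (excess u T q w z₂ z₁) volume s t :=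
    fun hs ht => intervalIntegrable_excess hu hT hq hMw h2 h21 h1.le hs ht
  have hmid : ∫ t in z₂..z₁, excess u T q w z₂ z₁ t = 0 := by
    rw [← neg_eq_zero, ← intervalIntegral.integral_neg, ← hint]
    refine intervalIntegral.integral_congr fun t ht => ?_
    rw [uIcc_of_le h21] at ht
    simp only [excess, multiplier, tailSlope]
    rw [threefold_of_mem ht, sub_sub_eq_add_sub, add_sub_right_comm]
    ring
  have htop : ∀ t ∈ Icc z₁ 1, 0 ≤ ∫ s in t..1, excess u T q w z₂ z₁ s := by
    intro t ht
    rcases ht.2.eq_or_lt with rfl | htlt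
    · simp
    rw [integral_excess_top hT h2 h21 ht.1 htlt]
    have hk : 0 < w - q z₁ + q z₂ := by linarith [hq.le z₁ hz1, hq.nonneg hz2]
    exact mul_nonneg (mul_nonneg (hu.deriv_pos hk).le (by linarith))
      (sub_nonneg.mpr (hfmono.monotoneOn ⟨ha1, h1⟩ ⟨ha1.trans ht.1, htlt⟩ ht.1))
  have hright : ∀ t ∈ Icc (pointA T) z₁, ∫ s in t..z₁, excess u T q w z₂ z₁ s ≤ 0 := by
    intro t ht
    rcases ht.2.eq_or_lt with rfl | htlt
    · simp
    · exact (integral_excess_nonpos hu hT hq hMw h2 h2a h1 ht.1 htlt).le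
  have hleft : 0 ≤ ∫ s in z₂..pointA T, excess u T q w z₂ z₁ s := by
    have := intervalIntegral.integral_add_adjacent_intervals (hii hz2 ham) (hii ham hz1)
    linarith [hright _ ⟨le_rfl, ha1⟩]
  -- The only use of the risk aversion condition here: between `z₂` and `a` the excess decreases, so
  -- it crosses zero at most once.
  have hanti : ∀ s t : ℝ, z₂ ≤ s → 0 < s → s ≤ t → t ≤ pointA T →
      excess u T q w z₂ z₁ t ≤ excess u T q w z₂ z₁ s := by
    intro s t hs hs0 hst hta
    have h := (strictAntiOn_marginal hu hT hq hAP hMW hWw (hq.nonneg hz2)).antitoneOn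
      ⟨hs0, hst.trans hta⟩ ⟨hs0.trans_le hst, hta⟩ hst
    simp only [excess]
    rw [threefold_of_mem ⟨hs, hst.trans (hta.trans ha1)⟩,
      threefold_of_mem ⟨hs.trans hst, hta.trans ha1⟩]
    simp only [sub_sub_eq_add_sub, add_sub_right_comm]
    linarith
  -- If `z₂ = a`, the vanishing integral forces `z₁ = a`; the contract is then zero and its mean
  -- cannot be `Δ > 0`.
  have h2lt : z₂ < pointA T := by
    refine lt_of_le_of_ne h2a fun h2eq => ?_
    have hz : z₁ = z₂ := by
      by_contra hne
      have hlt : pointA T < z₁ := lt_of_le_of_ne ha1 fun h => hne (h2eq.trans h).symm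
      have := integral_excess_nonpos hu hT hq hMw h2 h2a h1 le_rfl hlt
      rw [← h2eq, hmid] at this
      exact lt_irrefl _ this
    have h0 : ∀ t, threefold q z₂ z₁ t = 0 := by
      intro t
      simp only [threefold, hz, sub_self]
      split_ifs <;> rfl
    simp only [h0, intervalIntegral.integral_zero] at hmean
    exact hΔ.ne hmean
  refine ⟨hmid, ?_, ?_, ?_, htop⟩
  · rw [integral_excess_top hT h2 h21 le_rfl h1, sub_self, mul_zero]
  · intro t ht
    rcases ht.2.eq_or_lt with rfl | htlt
    · simp
    have h20 : 0 < z₂ := ht.1.trans_lt htlt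
    -- A negative value at `z₂` would persist up to `a` and contradict `hleft`. To the left of `z₂`
    -- the contract is zero and `T'` is larger, so nonnegativity spreads to all of `(0, z₂)`.
    have hn2 : 0 ≤ excess u T q w z₂ z₁ z₂ := by
      by_contra! hneg
      have hle : ∫ s in z₂..pointA T, excess u T q w z₂ z₁ s ≤
          ∫ _s in z₂..pointA T, excess u T q w z₂ z₁ z₂ :=
        intervalIntegral.integral_mono_on_of_le_Ioo h2a (hii hz2 ham) intervalIntegrable_const
          fun s hs => hanti z₂ s le_rfl h20 hs.1.le hs.2.le
      rw [intervalIntegral.integral_const, smul_eq_mul] at hle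
      nlinarith
    have := intervalIntegral.integral_mono_on_of_le_Ioo (μ := volume) (f := fun _ => (0 : ℝ))
      htlt.le intervalIntegrable_const
      (hii ⟨ht.1, ht.2.trans hz2.2⟩ hz2) fun s hs => ?_
    · simpa using this
    have hs0 : 0 < s := ht.1.trans_lt hs.1
    refine hn2.trans ?_
    have hq21 := hq.mono hz2 hz1 h21
    simp only [excess]
    rw [threefold_of_le le_rfl h21, threefold_of_le hs.2.le h21]
    refine sub_le_sub_right (mul_le_mul_of_nonneg_left ?_ ?_) _
    · exact hT.deriv_pointA.2.antitoneOn ⟨hs0, hs.2.le.trans h2a⟩ ⟨h20, h2a⟩ hs.2.le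
    · refine (hu.deriv_pos ?_).le
      linarith [hq.mem_Icc hz2 |>.1, hq.mem_Icc hz2 |>.2]
  · intro t ht
    rcases le_total (pointA T) t with hat | hta
    · exact hright t ⟨hat, ht.2⟩
    rcases ht.1.eq_or_lt with rfl | htlt
    · exact hmid.le
    have ht0 : 0 < t := h2.trans_lt htlt
    have htm : t ∈ Icc (0 : ℝ) 1 := ⟨ht0.le, hta.trans ha.2.le⟩
    -- By the single crossing, either the excess is nonnegative on `(z₂, t)`, or it is nonpositive
    -- on `(t, a)` and removing that part from `hleft` only increases the integral.
    suffices h : 0 ≤ ∫ s in z₂..t, excess u T q w z₂ z₁ s by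
      have := intervalIntegral.integral_add_adjacent_intervals (hii hz2 htm) (hii htm hz1)
      linarith
    rcases le_total 0 (excess u T q w z₂ z₁ t) with hnt | hnt
    · have := intervalIntegral.integral_mono_on_of_le_Ioo (μ := volume) (f := fun _ => (0 : ℝ))
        htlt.le intervalIntegrable_const (hii hz2 htm) fun s hs =>
          hnt.trans (hanti s t hs.1.le (h2.trans_lt hs.1) hs.2.le hta)
      simpa using this
    · have h1 := intervalIntegral.integral_mono_on_of_le_Ioo (μ := volume)
        (g := fun _ => (0 : ℝ)) hta (hii htm ham) intervalIntegrable_const fun s hs =>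
          (hanti t s htlt.le ht0 hs.1.le hs.2.le).trans hnt
      rw [intervalIntegral.integral_zero] at h1
      have := intervalIntegral.integral_add_adjacent_intervals (hii hz2 htm) (hii htm ham)
      linarith

/-- The threefold contract satisfies the variational inequality of the Lagrangian. -/
theorem IsThreefoldPair.integral_excess_mul_nonneg (hu : IsUtility u) (hT : IsWeighting T)
    (hq : IsLossQuantile q M) (hAP : RiskAversionCondition u T q W) (hMW : M ≤ W) (hWw : W < w)
    (hΔ : 0 < Δ) (hz : IsThreefoldPair u T q w Δ z₂ z₁) {R : ℝ → ℝ} (hR : R ∈ retentions M) :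
    0 ≤ ∫ t in (0 : ℝ)..1, excess u T q w z₂ z₁ t * (R (q t) - threefold q z₂ z₁ t) := by
  obtain ⟨e1, e2, s1, s2, s3⟩ := hz.integral_excess hu hT hq hAP hMW hWw hΔ
  obtain ⟨h2, h2a, ha1, h1, -, -⟩ := hz
  have h21 : z₂ ≤ z₁ := h2a.trans ha1
  have hMw : M < w := hMW.trans_lt hWw
  have hz1 : z₁ ∈ Icc (0 : ℝ) 1 := ⟨h2.trans h21, h1.le⟩
  have hz2 : z₂ ∈ Icc (0 : ℝ) 1 := ⟨h2, h21.trans h1.le⟩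
  have hq21 := hq.mono hz2 hz1 h21
  have h0m : (0 : ℝ) ∈ Icc (0 : ℝ) 1 := ⟨le_rfl, zero_le_one⟩
  have h1m : (1 : ℝ) ∈ Icc (0 : ℝ) 1 := ⟨zero_le_one, le_rfl⟩
  have hii : ∀ {s t : ℝ}, s ∈ Icc (0 : ℝ) 1 → t ∈ Icc (0 : ℝ) 1 →
      IntervalIntegrable (excess u T q w z₂ z₁) volume s t :=
    fun hs ht => intervalIntegrable_excess hu hT hq hMw h2 h21 h1.le hs ht
  -- Agrees with `R ∘ q` minus the contract on `[0,1]`; in this form absolute continuity is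
  -- immediate.
  set D : ℝ → ℝ := fun t => R (q t) - layer (q z₂) (q z₁) (q t) with hD
  have hDac : AbsolutelyContinuousOnInterval D 0 1 :=
    (hq.ac_comp hR).fun_sub (hq.ac_comp (layer_mem_retentions (hq.nonneg hz2) hq21))
  have hDeq : EqOn (fun t => R (q t) - threefold q z₂ z₁ t) D (Icc 0 1) := fun t ht => by
    simp only [hD]
    rw [threefold_eq_layer hq h2 h21 h1.le ht]
  have hac : ∀ {s t : ℝ}, s ∈ Icc (0 : ℝ) 1 → t ∈ Icc (0 : ℝ) 1 →
      AbsolutelyContinuousOnInterval D s t := fun hs ht => hDac.mono (by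
    rw [uIcc_of_le (zero_le_one' ℝ)]
    exact uIcc_subset_Icc hs ht)
  have hRmono : ∀ s ∈ Icc (0 : ℝ) 1, ∀ t ∈ Icc (0 : ℝ) 1, s ≤ t →
      0 ≤ R (q t) - R (q s) ∧ R (q t) - R (q s) ≤ q t - q s := fun s hs t ht hst =>
    hR.2 _ _ (hq.nonneg hs) (hq.mono hs ht hst) (hq.le t ht)
  have hm1 : MonotoneOn D (Icc 0 z₂) := by
    intro s hs t ht hst
    have hsm : s ∈ Icc (0 : ℝ) 1 := ⟨hs.1, hs.2.trans hz2.2⟩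
    have htm : t ∈ Icc (0 : ℝ) 1 := ⟨ht.1, ht.2.trans hz2.2⟩
    rw [← hDeq hsm, ← hDeq htm]
    simp only
    rw [threefold_of_le hs.2 h21, threefold_of_le ht.2 h21]
    linarith [(hRmono s hsm t htm hst).1]
  have hm2 : MonotoneOn (fun t => -D t) (Icc z₂ z₁) := by
    intro s hs t ht hst
    have hsm : s ∈ Icc (0 : ℝ) 1 := ⟨h2.trans hs.1, hs.2.trans h1.le⟩
    have htm : t ∈ Icc (0 : ℝ) 1 := ⟨h2.trans ht.1, ht.2.trans h1.le⟩
    simp only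
    rw [← hDeq hsm, ← hDeq htm]
    simp only
    rw [threefold_of_mem hs, threefold_of_mem ht]
    linarith [(hRmono s hsm t htm hst).2]
  have hm3 : MonotoneOn D (Icc z₁ 1) := by
    intro s hs t ht hst
    have hsm : s ∈ Icc (0 : ℝ) 1 := ⟨hz1.1.trans hs.1, hs.2⟩
    have htm : t ∈ Icc (0 : ℝ) 1 := ⟨hz1.1.trans ht.1, ht.2⟩
    rw [← hDeq hsm, ← hDeq htm]
    simp only
    rw [threefold_of_ge hs.1 h21, threefold_of_ge ht.1 h21]
    linarith [(hRmono s hsm t htm hst).1]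
  -- All three lower bounds turn out to be zero: `D 0 = 0` on the first piece, and the excess has
  -- zero total on the other two. On the middle piece both factors are negated.
  have i1 := mul_integral_le_integral_mul h2 (hii h0m hz2) (hac h0m hz2) hm1 s1
  have i2 := mul_integral_le_integral_mul h21 (hii hz2 hz1).neg (hac hz2 hz1).fun_neg hm2
    fun t ht => by
      simp only [Pi.neg_apply]
      rw [intervalIntegral.integral_neg]
      linarith [s2 t ht]
  have i3 := mul_integral_le_integral_mul h1.le (hii hz1 h1m) (hac hz1 h1m) hm3 s3
  have hD0 : D 0 = 0 := by
    rw [← hDeq h0m]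
    simp only
    rw [threefold_of_le h2 h21, hq.zero, hR.1, sub_zero]
  simp only [Pi.neg_apply, neg_mul_neg, intervalIntegral.integral_neg] at i2
  rw [hD0, zero_mul] at i1
  rw [e1, mul_zero] at i2
  rw [e2, mul_zero] at i3
  have hiD : ∀ {s t : ℝ}, s ∈ Icc (0 : ℝ) 1 → t ∈ Icc (0 : ℝ) 1 →
      IntervalIntegrable (fun τ => excess u T q w z₂ z₁ τ * D τ) volume s t :=
    fun hs ht => (hii hs ht).mul_continuousOn (hac hs ht).continuousOn
  have hsum : ∫ t in (0 : ℝ)..1, excess u T q w z₂ z₁ t * D t =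
      (∫ t in (0 : ℝ)..z₂, excess u T q w z₂ z₁ t * D t) +
      (∫ t in z₂..z₁, excess u T q w z₂ z₁ t * D t) +
      ∫ t in z₁..1, excess u T q w z₂ z₁ t * D t := by
    rw [intervalIntegral.integral_add_adjacent_intervals (hiD h0m hz2) (hiD hz2 hz1),
      intervalIntegral.integral_add_adjacent_intervals (hiD h0m hz1) (hiD hz1 h1m)]
  have hcongr : ∫ t in (0 : ℝ)..1, excess u T q w z₂ z₁ t * (R (q t) - threefold q z₂ z₁ t) =
      ∫ t in (0 : ℝ)..1, excess u T q w z₂ z₁ t * D t := by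
    refine intervalIntegral.integral_congr fun t ht => ?_
    rw [uIcc_of_le (zero_le_one' ℝ)] at ht
    rw [← hDeq ht]
  rw [hcongr, hsum]
  linarith

end Optimality

/-! ### Strict concavity and uniqueness -/

section Comparison

variable {u T q : ℝ → ℝ} {M W w Δ z₂ z₁ : ℝ}

theorem IsUtility.continuousOn (hu : IsUtility u) : ContinuousOn u (Ioi 0) :=
  fun _ hx => (hu.hasDerivAt hx).continuousAt.continuousWithinAt

theorem objective_congr {G G' : ℝ → ℝ} (h : EqOn G G' (Icc 0 1)) :
    objective u T w G = objective u T w G' := by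
  refine intervalIntegral.integral_congr fun t ht => ?_
  rw [uIcc_of_le (zero_le_one' ℝ)] at ht
  rw [h ht]

theorem integral_congr_Icc {G G' : ℝ → ℝ} (h : EqOn G G' (Icc 0 1)) :
    ∫ t in (0 : ℝ)..1, G t = ∫ t in (0 : ℝ)..1, G' t :=
  intervalIntegral.integral_congr (by rwa [uIcc_of_le (zero_le_one' ℝ)])

/-- A feasible retention that does not do worse than the threefold contract coincides with it. -/
theorem IsThreefoldPair.eqOn_of_objective_le (hu : IsUtility u) (hT : IsWeighting T)
    (hq : IsLossQuantile q M) (hAP : RiskAversionCondition u T q W) (hMW : M ≤ W) (hWw : W < w)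
    (hΔ : 0 < Δ) (hz : IsThreefoldPair u T q w Δ z₂ z₁) {R : ℝ → ℝ} (hR : R ∈ retentions M)
    (hmean : Δ ≤ ∫ t in (0 : ℝ)..1, R (q t))
    (hobj : objective u T w (threefold q z₂ z₁) ≤ objective u T w fun t => R (q t)) :
    EqOn (fun t => R (q t)) (threefold q z₂ z₁) (Icc 0 1) := by
  have hvar := hz.integral_excess_mul_nonneg hu hT hq hAP hMW hWw hΔ hR
  obtain ⟨h2, h2a, ha1, h1, -, hg⟩ := hz
  have h21 : z₂ ≤ z₁ := h2a.trans ha1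
  have hMw : M < w := hMW.trans_lt hWw
  have hz1 : z₁ ∈ Icc (0 : ℝ) 1 := ⟨h2.trans h21, h1.le⟩
  have hz2 : z₂ ∈ Icc (0 : ℝ) 1 := ⟨h2, h21.trans h1.le⟩
  have h0m : (0 : ℝ) ∈ Icc (0 : ℝ) 1 := ⟨le_rfl, zero_le_one⟩
  have h1m : (1 : ℝ) ∈ Icc (0 : ℝ) 1 := ⟨zero_le_one, le_rfl⟩
  have hII : uIcc (0 : ℝ) 1 = Icc 0 1 := uIcc_of_le zero_le_one
  set G : ℝ → ℝ := fun t => R (q t) with hG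
  set g : ℝ → ℝ := threefold q z₂ z₁ with hgdef
  have hGc : ContinuousOn G (Icc 0 1) := hII ▸ (hq.ac_comp hR).continuousOn
  have hgc : ContinuousOn g (Icc 0 1) := continuousOn_threefold hq h2 h21 h1.le
  have hGpos : ∀ t ∈ Icc (0 : ℝ) 1, 0 < w - G t := fun t ht => by
    have := (retentions.le_self hR (hq.mem_Icc ht)).trans (hq.le t ht)
    simp only [hG]
    linarith
  have hgpos : ∀ t ∈ Icc (0 : ℝ) 1, 0 < w - g t := fun t ht => by
    have := threefold_le hq h2 h21 h1.le ht
    linarith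
  have hTi := hT.intervalIntegrable_deriv h0m h1m
  have hiG : IntervalIntegrable (fun t => u (w - G t) * deriv T t) volume 0 1 :=
    hTi.continuousOn_mul (hII ▸ hu.continuousOn.comp (continuousOn_const.sub hGc) hGpos)
  have hig : IntervalIntegrable (fun t => u (w - g t) * deriv T t) volume 0 1 :=
    hTi.continuousOn_mul (hII ▸ hu.continuousOn.comp (continuousOn_const.sub hgc) hgpos)
  have him : IntervalIntegrable (fun t => deriv u (w - g t) * deriv T t * (G t - g t))
      volume 0 1 :=
    (intervalIntegrable_marginal hu hT hgc (fun t ht => sub_pos.mp (hgpos t ht)) h0m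
      h1m).mul_continuousOn (hII ▸ hGc.sub hgc)
  have hGi : IntervalIntegrable G volume 0 1 := (hII ▸ hGc : ContinuousOn G _).intervalIntegrable
  have hgi : IntervalIntegrable g volume 0 1 := (hII ▸ hgc : ContinuousOn g _).intervalIntegrable
  have hlam : 0 ≤ multiplier u T q w z₂ z₁ :=
    mul_nonneg (hu.deriv_pos (by linarith [hq.le z₁ hz1, hq.nonneg hz2])).le
      (hT.tailSlope_pos ⟨hz1.1, h1⟩).le
  -- Adding back `λ (∫ G - Δ)`, which is nonnegative by feasibility and `λ ≥ 0`, to the variational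
  -- inequality.
  have hfirst : 0 ≤ ∫ t in (0 : ℝ)..1, deriv u (w - g t) * deriv T t * (G t - g t) := by
    have he : ∫ t in (0 : ℝ)..1, excess u T q w z₂ z₁ t * (G t - g t) =
        (∫ t in (0 : ℝ)..1, deriv u (w - g t) * deriv T t * (G t - g t)) -
          multiplier u T q w z₂ z₁ * ((∫ t in (0 : ℝ)..1, G t) - ∫ t in (0 : ℝ)..1, g t) := by
      rw [← intervalIntegral.integral_sub hGi hgi, ← intervalIntegral.integral_const_mul,
        ← intervalIntegral.integral_sub him ((hGi.sub hgi).const_mul _)]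
      refine intervalIntegral.integral_congr fun t _ => ?_
      simp only [excess]
      ring
    rw [he, hg] at hvar
    nlinarith [mul_nonneg hlam (sub_nonneg.mpr hmean)]
  -- Tangent-line defect of `u` weighted by `T'`. It is nonnegative almost everywhere on `[0,1]`,
  -- while `hobj` and `hfirst` make its integral nonpositive, so it vanishes almost everywhere.
  set e : ℝ → ℝ := fun t => u (w - g t) * deriv T t - u (w - G t) * deriv T t -
    deriv u (w - g t) * deriv T t * (G t - g t) with he
  have hei : IntervalIntegrable e volume 0 1 := (hig.sub hiG).sub him
  have heq : ∀ t, e t =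
      (u (w - g t) + deriv u (w - g t) * ((w - G t) - (w - g t)) - u (w - G t)) * deriv T t :=
    fun t => by simp only [he]; ring
  have hIoo : ∀ᵐ t ∂volume.restrict (Ioc (0 : ℝ) 1), t ∈ Ioo (0 : ℝ) 1 := by
    rw [ae_restrict_congr_set Ioo_ae_eq_Ioc.symm]
    exact ae_restrict_mem measurableSet_Ioo
  have he0 : 0 ≤ᵐ[volume.restrict (Ioc (0 : ℝ) 1)] e := by
    filter_upwards [hIoo] with t ht
    have htm := Ioo_subset_Icc_self ht
    rw [Pi.zero_apply, heq]
    refine mul_nonneg ?_ (hT.deriv_nonneg ht)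
    by_cases hne : w - G t = w - g t
    · rw [hne]; simp
    · linarith [hu.lt_tangent (hgpos t htm) (hGpos t htm) hne]
  have hle : ∫ t in (0 : ℝ)..1, e t ≤ 0 := by
    simp only [he]
    rw [intervalIntegral.integral_sub (hig.sub hiG) him, intervalIntegral.integral_sub hig hiG]
    change objective u T w g - objective u T w G - _ ≤ 0
    linarith
  have hzero : ∫ t in (0 : ℝ)..1, e t = 0 :=
    le_antisymm hle (intervalIntegral.integral_nonneg_of_ae_restrict zero_le_one
      (by rwa [← Measure.restrict_congr_set Ioc_ae_eq_Icc]))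
  have hae := (intervalIntegral.integral_eq_zero_iff_of_le_of_nonneg_ae zero_le_one he0 hei).mp
    hzero
  obtain ⟨b, hb⟩ := hT.exists_forall_deriv_pos
  refine Measure.eqOn_Icc_of_ae_eq volume zero_ne_one ?_ hGc hgc
  rw [← Measure.restrict_congr_set Ioc_ae_eq_Icc]
  have hbne : ∀ᵐ t ∂volume.restrict (Ioc (0 : ℝ) 1), t ≠ b :=
    ae_restrict_of_ae (by simp [ae_iff, measure_singleton])
  filter_upwards [hae, hIoo, hbne] with t h0 ht htb
  by_contra hne
  have htm := Ioo_subset_Icc_self ht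
  rw [heq, Pi.zero_apply] at h0
  have h3 := hu.lt_tangent (hgpos t htm) (hGpos t htm) fun h => hne (by linarith)
  exact (mul_pos (sub_pos.mpr h3) (hb t ht htb)).ne' h0

end Comparison

/-! ### Existence of the pair `(z₂, z₁)` -/

section Existence

variable {u T q : ℝ → ℝ} {M W w z₂ z₁ : ℝ}

/-- The integral that has to vanish for the pair `(z₂, z₁)`. -/
def gap (u T q : ℝ → ℝ) (w z₂ z₁ : ℝ) : ℝ :=
  ∫ t in z₂..z₁, (deriv u (w - q z₁ + q z₂) * (1 - T z₁) / (1 - z₁)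
    - deriv u (w - q t + q z₂) * deriv T t)

theorem hFun_eq_gap (hq : IsLossQuantile q M) (z : ℝ) : hFun u T q w z = gap u T q w 0 z := by
  simp [hFun, gap, hq.zero]

theorem intervalIntegrable_shifted (hu : IsUtility u) (hT : IsWeighting T)
    (hq : IsLossQuantile q M) (hMw : M < w) {κ : ℝ} (hκ : 0 ≤ κ) {s t : ℝ}
    (hs : s ∈ Icc (0 : ℝ) 1) (ht : t ∈ Icc (0 : ℝ) 1) :
    IntervalIntegrable (fun z => deriv u (w - q z + κ) * deriv T z) volume s t := by
  have h := intervalIntegrable_marginal (w := w) (G := fun z => q z - κ) hu hT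
    (hq.continuousOn.sub continuousOn_const)
    (fun z hz => by linarith [hq.le z hz]) hs ht
  simpa only [sub_sub_eq_add_sub, add_sub_right_comm] using h

theorem gap_eq (hu : IsUtility u) (hT : IsWeighting T)
    (hq : IsLossQuantile q M) (hMw : M < w) (h2 : z₂ ∈ Icc (0 : ℝ) 1) (h1 : z₁ ∈ Icc (0 : ℝ) 1) :
    gap u T q w z₂ z₁ = multiplier u T q w z₂ z₁ * (z₁ - z₂) -
      ∫ t in z₂..z₁, deriv u (w - q t + q z₂) * deriv T t := by
  rw [gap, intervalIntegral.integral_sub intervalIntegrable_const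
    (intervalIntegrable_shifted hu hT hq hMw (hq.nonneg h2) h2 h1),
    intervalIntegral.integral_const, smul_eq_mul, multiplier, tailSlope, mul_div_assoc,
    mul_comm (z₁ - z₂)]

theorem multiplier_mono (hu : IsUtility u) (hT : IsWeighting T) (hq : IsLossQuantile q M)
    (hMw : M < w) (h2 : z₂ ∈ Icc (0 : ℝ) 1) {x y : ℝ} (hx : pointA T ≤ x) (hxy : x ≤ y)
    (hy : y < 1) : multiplier u T q w z₂ x ≤ multiplier u T q w z₂ y := by
  obtain ⟨ha, -, hmono⟩ := hT.pointA_spec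
  have hxm : x ∈ Icc (0 : ℝ) 1 := ⟨ha.1.le.trans hx, hxy.trans hy.le⟩
  have hym : y ∈ Icc (0 : ℝ) 1 := ⟨hxm.1.trans hxy, hy.le⟩
  have hqxy := hq.mono hxm hym hxy
  have hky : 0 < w - q y + q z₂ := by linarith [hq.le y hym, hq.nonneg h2]
  have hkx : 0 < w - q x + q z₂ := by linarith
  exact mul_le_mul (hu.deriv_strictAnti.antitoneOn hky hkx (by linarith))
    (hmono.monotoneOn ⟨hx, hxy.trans_lt hy⟩ ⟨hx.trans hxy, hy⟩ hxy)
    (hT.tailSlope_pos ⟨hxm.1, hxy.trans_lt hy⟩).le (hu.deriv_pos hky).le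

/-- For `x < y`, with `m` the multiplier, the increment is `(m(y) - m(x))(x - z₂)` minus the
integral of the excess of the pair `(z₂, y)` over `[x,y]`. The first term is nonnegative and the
integral is negative. -/
theorem gap_strictMonoOn (hu : IsUtility u) (hT : IsWeighting T)
    (hq : IsLossQuantile q M) (hMw : M < w) (h2 : z₂ ∈ Icc 0 (pointA T)) :
    StrictMonoOn (gap u T q w z₂) (Ico (pointA T) 1) := by
  intro x hx y hy hxy
  have ha := hT.pointA_mem
  have h2m : z₂ ∈ Icc (0 : ℝ) 1 := ⟨h2.1, h2.2.trans ha.2.le⟩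
  have hxm : x ∈ Icc (0 : ℝ) 1 := ⟨ha.1.le.trans hx.1, hx.2.le⟩
  have hym : y ∈ Icc (0 : ℝ) 1 := ⟨ha.1.le.trans hy.1, hy.2.le⟩
  have hneg := integral_excess_nonpos (z₁ := y) hu hT hq hMw h2.1 h2.2 hy.2 hx.1 hxy
  have hsplit := intervalIntegral.integral_add_adjacent_intervals
    (intervalIntegrable_shifted hu hT hq hMw (hq.nonneg h2m) h2m hxm)
    (intervalIntegrable_shifted hu hT hq hMw (hq.nonneg h2m) hxm hym)
  have he : ∫ t in x..y, excess u T q w z₂ y t =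
      (∫ t in x..y, deriv u (w - q t + q z₂) * deriv T t) -
        multiplier u T q w z₂ y * (y - x) := by
    rw [mul_comm, ← smul_eq_mul (y - x), ← intervalIntegral.integral_const,
      ← intervalIntegral.integral_sub
        (intervalIntegrable_shifted hu hT hq hMw (hq.nonneg h2m) hxm hym)
        intervalIntegrable_const]
    refine intervalIntegral.integral_congr fun t ht => ?_
    rw [uIcc_of_le hxy.le] at ht
    simp only [excess]
    rw [threefold_of_mem ⟨h2.2.trans (hx.1.trans ht.1), ht.2⟩, sub_sub_eq_add_sub,
      add_sub_right_comm]
  rw [gap_eq hu hT hq hMw h2m hxm, gap_eq hu hT hq hMw h2m hym]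
  have hm := multiplier_mono hu hT hq hMw h2m hx.1 hxy.le hy.2
  nlinarith [mul_nonneg (sub_nonneg.mpr hm) (sub_nonneg.mpr (h2.2.trans hx.1))]

/-- Since `T'(a) = f(a)`, the integrand is the strictly decreasing marginal at `a` minus its value
at `t < a`. -/
theorem gap_pointA_neg (hu : IsUtility u) (hT : IsWeighting T) (hq : IsLossQuantile q M)
    (hAP : RiskAversionCondition u T q W) (hMW : M ≤ W) (hWw : W < w)
    (h2 : z₂ ∈ Ico 0 (pointA T)) : gap u T q w z₂ (pointA T) < 0 := by
  have ha := hT.pointA_mem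
  have ham := Ioo_subset_Icc_self ha
  have h2m : z₂ ∈ Icc (0 : ℝ) 1 := ⟨h2.1, (h2.2.trans ha.2).le⟩
  rw [gap, ← neg_pos, ← intervalIntegral.integral_neg]
  refine intervalIntegral.intervalIntegral_pos_of_pos_on
    (intervalIntegrable_const.sub (intervalIntegrable_shifted hu hT hq (hMW.trans_lt hWw)
      (hq.nonneg h2m) h2m ham)).neg (fun t ht => ?_) h2.2
  have h := strictAntiOn_marginal hu hT hq hAP hMW hWw (hq.nonneg h2m)
    ⟨h2.1.trans_lt ht.1, ht.2.le⟩ ⟨ha.1, le_rfl⟩ ht.2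
  simp only at h
  rw [hT.deriv_pointA.1, tailSlope, ← mul_div_assoc] at h
  linarith

/-- Bounding `u'` by its value at `c` and using `f(c) = 1`, `T c = c` leaves a positive multiple of
`T z₂ - z₂`, nonnegative to the left of `a`. -/
theorem gap_pointC_nonneg (hu : IsUtility u) (hT : IsWeighting T) (hq : IsLossQuantile q M)
    (hMw : M < w) (h2 : z₂ ∈ Icc 0 (pointA T)) : 0 ≤ gap u T q w z₂ (pointC T) := by
  have ha := hT.pointA_mem
  have hc := hT.pointC_spec.1
  have h2m : z₂ ∈ Icc (0 : ℝ) 1 := ⟨h2.1, h2.2.trans ha.2.le⟩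
  have hcm : pointC T ∈ Icc (0 : ℝ) 1 := ⟨(ha.1.trans hc.1).le, hc.2.le⟩
  have h2c : z₂ ≤ pointC T := h2.2.trans hc.1.le
  have hk : 0 < w - q (pointC T) + q z₂ := by linarith [hq.le _ hcm, hq.nonneg h2m]
  have hle : ∫ t in z₂..pointC T, deriv u (w - q t + q z₂) * deriv T t ≤
      ∫ t in z₂..pointC T, deriv u (w - q (pointC T) + q z₂) * deriv T t := by
    refine intervalIntegral.integral_mono_on_of_le_Ioo h2c
      (intervalIntegrable_shifted hu hT hq hMw (hq.nonneg h2m) h2m hcm)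
      ((hT.intervalIntegrable_deriv h2m hcm).const_mul _) fun t ht => ?_
    have htm : t ∈ Ioo (0 : ℝ) 1 := ⟨h2.1.trans_lt ht.1, ht.2.trans hc.2⟩
    have hqt := hq.mono (Ioo_subset_Icc_self htm) hcm ht.2.le
    exact mul_le_mul_of_nonneg_right (hu.deriv_strictAnti.antitoneOn hk
      (by simp only [mem_Ioi]; linarith) (by linarith)) (hT.deriv_nonneg htm)
  rw [intervalIntegral.integral_const_mul, hT.integral_deriv h2.1 h2c hc.2.le,
    hT.pointC_fixed] at hle
  rw [gap_eq hu hT hq hMw h2m hcm, multiplier, hT.pointC_spec.2, mul_one]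
  nlinarith [mul_nonneg (hu.deriv_pos hk).le (sub_nonneg.mpr (hT.le_self h2))]

/-- Continuous dependence of weighted integrals over a layer on its end points. -/
theorem continuousOn_integral_layer (hq : IsLossQuantile q M) {φ k α β : ℝ → ℝ} {S : Set ℝ}
    (hφ : ContinuousOn φ (Icc 0 M)) (hk : IntervalIntegrable k volume 0 1)
    (hα : ContinuousOn α S) (hβ : ContinuousOn β S) (hαm : MapsTo α S (Icc 0 1))
    (hβm : MapsTo β S (Icc 0 1)) (hαβ : ∀ z ∈ S, α z ≤ β z) :
    ContinuousOn (fun z => ∫ t in (0 : ℝ)..1, φ (layer (q (α z)) (q (β z)) (q t)) * k t) S := by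
  have hII : uIcc (0 : ℝ) 1 = Icc 0 1 := uIcc_of_le zero_le_one
  obtain ⟨C, hC⟩ := isCompact_Icc.exists_bound_of_continuousOn hφ
  have hmem : ∀ z ∈ S, ∀ t ∈ Icc (0 : ℝ) 1, layer (q (α z)) (q (β z)) (q t) ∈ Icc 0 M := by
    intro z hz t ht
    have hR := layer_mem_retentions (M := M) (hq.nonneg (hαm hz))
      (hq.mono (hαm hz) (hβm hz) (hαβ z hz))
    exact ⟨retentions.nonneg hR (hq.mem_Icc ht),
      (retentions.le_self hR (hq.mem_Icc ht)).trans (hq.le t ht)⟩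
  have hIm : ∀ t ∈ uIoc (0 : ℝ) 1, t ∈ Icc (0 : ℝ) 1 := fun t ht =>
    hII ▸ uIoc_subset_uIcc ht
  intro z₀ hz₀
  -- With fixed limits the end points enter only through the integrand, so dominated convergence
  -- applies; `C` bounds `φ` on `[0,M]`.
  refine intervalIntegral.continuousWithinAt_of_dominated_interval
    (bound := fun t => C * ‖k t‖) ?_ ?_ (hk.norm.const_mul C) ?_
  · filter_upwards [self_mem_nhdsWithin] with z hz
    have hlc : ContinuousOn (fun t => layer (q (α z)) (q (β z)) (q t)) (Icc 0 1) :=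
      ((hq.continuousOn.sup continuousOn_const).inf continuousOn_const).sub continuousOn_const
    have hφc : ContinuousOn (fun t => φ (layer (q (α z)) (q (β z)) (q t))) (uIcc 0 1) :=
      hII ▸ hφ.comp hlc (hmem z hz)
    have hi := (hk.continuousOn_mul hφc).aestronglyMeasurable
    rwa [← uIoc_of_le (zero_le_one' ℝ)] at hi
  · filter_upwards [self_mem_nhdsWithin] with z hz
    refine Eventually.of_forall fun t ht => ?_
    rw [norm_mul]
    exact mul_le_mul_of_nonneg_right (hC _ (hmem z hz t (hIm t ht))) (norm_nonneg _)
  · refine Eventually.of_forall fun t ht => ?_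
    have h1 : ContinuousOn (fun z => layer (q (α z)) (q (β z)) (q t)) S := by
      have hqa := hq.continuousOn.comp hα hαm
      have hqb := hq.continuousOn.comp hβ hβm
      exact ((continuousOn_const.sup hqa).inf hqb).sub hqa
    exact ((hφ.comp h1 fun z hz => hmem z hz t (hIm t ht)).mul continuousOn_const) z₀ hz₀

/-- Extending the integral to `[0,1]` adds explicit terms from the two flat pieces. The fixed limits
bring it into the form of `continuousOn_integral_layer`. -/
theorem gap_eq_layer (hu : IsUtility u) (hT : IsWeighting T) (hq : IsLossQuantile q M)
    (hMw : M < w) (h2 : 0 ≤ z₂) (h21 : z₂ ≤ z₁) (h1 : z₁ < 1) :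
    gap u T q w z₂ z₁ = multiplier u T q w z₂ z₁ * (1 - z₂) + deriv u w * T z₂ -
      ∫ t in (0 : ℝ)..1, deriv u (w - layer (q z₂) (q z₁) (q t)) * deriv T t := by
  have h0m : (0 : ℝ) ∈ Icc (0 : ℝ) 1 := ⟨le_rfl, zero_le_one⟩
  have h1m : (1 : ℝ) ∈ Icc (0 : ℝ) 1 := ⟨zero_le_one, le_rfl⟩
  have hz1 : z₁ ∈ Icc (0 : ℝ) 1 := ⟨h2.trans h21, h1.le⟩
  have hz2 : z₂ ∈ Icc (0 : ℝ) 1 := ⟨h2, h21.trans h1.le⟩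
  have hii : ∀ {s t : ℝ}, s ∈ Icc (0 : ℝ) 1 → t ∈ Icc (0 : ℝ) 1 →
      IntervalIntegrable (fun t => deriv u (w - threefold q z₂ z₁ t) * deriv T t) volume s t :=
    fun hs ht => intervalIntegrable_marginal hu hT (continuousOn_threefold hq h2 h21 h1.le)
      (fun t ht => (threefold_le hq h2 h21 h1.le ht).trans_lt hMw) hs ht
  have hc : ∫ t in (0 : ℝ)..1, deriv u (w - layer (q z₂) (q z₁) (q t)) * deriv T t =
      ∫ t in (0 : ℝ)..1, deriv u (w - threefold q z₂ z₁ t) * deriv T t := by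
    refine integral_congr_Icc fun t ht => ?_
    rw [threefold_eq_layer hq h2 h21 h1.le ht]
  have i1 : ∫ t in (0 : ℝ)..z₂, deriv u (w - threefold q z₂ z₁ t) * deriv T t =
      deriv u w * T z₂ := by
    have hTz := hT.integral_deriv le_rfl h2 hz2.2
    rw [hT.zero, sub_zero] at hTz
    rw [← hTz, ← intervalIntegral.integral_const_mul]
    refine intervalIntegral.integral_congr fun t ht => ?_
    rw [uIcc_of_le h2] at ht
    rw [threefold_of_le ht.2 h21, sub_zero]
  have i2 : ∫ t in z₂..z₁, deriv u (w - threefold q z₂ z₁ t) * deriv T t =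
      ∫ t in z₂..z₁, deriv u (w - q t + q z₂) * deriv T t := by
    refine intervalIntegral.integral_congr fun t ht => ?_
    rw [uIcc_of_le h21] at ht
    rw [threefold_of_mem ht, sub_sub_eq_add_sub, add_sub_right_comm]
  have i3 : ∫ t in z₁..1, deriv u (w - threefold q z₂ z₁ t) * deriv T t =
      multiplier u T q w z₂ z₁ * (1 - z₁) := by
    rw [multiplier, mul_assoc, tailSlope_mul h1]
    nth_rewrite 2 [← hT.one]
    rw [← hT.integral_deriv hz1.1 h1.le le_rfl, ← intervalIntegral.integral_const_mul]
    refine intervalIntegral.integral_congr fun t ht => ?_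
    rw [uIcc_of_le h1.le] at ht
    rw [threefold_of_ge ht.1 h21, sub_sub_eq_add_sub, add_sub_right_comm]
  rw [gap_eq hu hT hq hMw hz2 hz1, hc,
    ← intervalIntegral.integral_add_adjacent_intervals (hii h0m hz1) (hii hz1 h1m),
    ← intervalIntegral.integral_add_adjacent_intervals (hii h0m hz2) (hii hz2 hz1), i1, i2, i3]
  ring

theorem continuousOn_gap (hu : IsUtility u) (hT : IsWeighting T) (hq : IsLossQuantile q M)
    (hMw : M < w) {α β : ℝ → ℝ} {S : Set ℝ} (hα : ContinuousOn α S) (hβ : ContinuousOn β S)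
    (hα0 : ∀ z ∈ S, 0 ≤ α z) (hαβ : ∀ z ∈ S, α z ≤ β z) (hβ1 : ∀ z ∈ S, β z < 1) :
    ContinuousOn (fun z => gap u T q w (α z) (β z)) S := by
  have hαm : MapsTo α S (Icc 0 1) := fun z hz => ⟨hα0 z hz, (hαβ z hz).trans (hβ1 z hz).le⟩
  have hβm : MapsTo β S (Icc 0 1) := fun z hz => ⟨(hα0 z hz).trans (hαβ z hz), (hβ1 z hz).le⟩
  have hqa := hq.continuousOn.comp hα hαm
  have hqb := hq.continuousOn.comp hβ hβm
  have hmul : ContinuousOn (fun z => multiplier u T q w (α z) (β z)) S := by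
    refine ContinuousOn.mul ?_ (hT.continuousOn_tailSlope.comp hβ fun z hz =>
      ⟨(hβm hz).1, hβ1 z hz⟩)
    refine hu.continuousOn_deriv.comp ((continuousOn_const.sub hqb).add hqa) fun z hz => ?_
    have h1 := hq.le _ (hβm hz)
    have h2 := hq.nonneg (hαm hz)
    change 0 < w - q (β z) + q (α z)
    linarith
  have hlay := continuousOn_integral_layer (φ := fun x => deriv u (w - x)) hq
    (hu.continuousOn_deriv.comp (continuousOn_const.sub continuousOn_id) fun x hx => by
      have := hx.2
      change 0 < w - x
      linarith) (hT.intervalIntegrable_deriv ⟨le_rfl, zero_le_one⟩ ⟨zero_le_one, le_rfl⟩)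
    hα hβ hαm hβm hαβ
  exact (((hmul.mul ((continuousOn_const (c := (1 : ℝ))).sub hα)).add
    ((continuousOn_const (c := deriv u w)).mul (hT.continuous.comp hα hαm))).sub hlay).congr
    fun z hz => gap_eq_layer hu hT hq hMw (hα0 z hz) (hαβ z hz) (hβ1 z hz)

theorem exists_gap_eq_zero (hu : IsUtility u) (hT : IsWeighting T) (hq : IsLossQuantile q M)
    (hAP : RiskAversionCondition u T q W) (hMW : M ≤ W) (hWw : W < w)
    (h2 : z₂ ∈ Icc 0 (pointA T)) :
    ∃ z₁ ∈ Icc (pointA T) (pointC T), gap u T q w z₂ z₁ = 0 := by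
  have hc := hT.pointC_spec.1
  have hcont : ContinuousOn (fun z => gap u T q w z₂ z) (Icc (pointA T) (pointC T)) :=
    continuousOn_gap hu hT hq (hMW.trans_lt hWw) continuousOn_const continuousOn_id
      (fun _ _ => h2.1) (fun z hz => h2.2.trans hz.1) (fun z hz => hz.2.trans_lt hc.2)
  refine intermediate_value_Icc hc.1.le hcont
    ⟨?_, gap_pointC_nonneg hu hT hq (hMW.trans_lt hWw) h2⟩
  rcases h2.2.eq_or_lt with h | h
  · simp [gap, h]
  · exact (gap_pointA_neg hu hT hq hAP hMW hWw ⟨h2.1, h⟩).le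

theorem pointL_spec (hu : IsUtility u) (hT : IsWeighting T) (hq : IsLossQuantile q M)
    (hAP : RiskAversionCondition u T q W) (hMW : M ≤ W) (hWw : W < w) :
    pointL u T q w ∈ Ioc (pointA T) (pointC T) ∧ hFun u T q w (pointL u T q w) = 0 := by
  have ha := hT.pointA_mem
  refine Classical.epsilon_spec
    (p := fun l : ℝ => l ∈ Ioc (pointA T) (pointC T) ∧ hFun u T q w l = 0) ?_
  obtain ⟨l, hl, h0⟩ := exists_gap_eq_zero hu hT hq hAP hMW hWw ⟨le_rfl, ha.1.le⟩
  refine ⟨l, ⟨lt_of_le_of_ne hl.1 ?_, hl.2⟩, (hFun_eq_gap hq l).trans h0⟩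
  rintro rfl
  exact (gap_pointA_neg hu hT hq hAP hMW hWw ⟨le_rfl, ha.1⟩).ne h0

theorem threshold_eq (hq : IsLossQuantile q M) :
    threshold u T q w = ∫ z in (0 : ℝ)..1, threefold q 0 (pointL u T q w) z := by
  refine integral_congr_Icc fun z hz => ?_
  simp only [deductible, threefold, if_neg (not_lt.mpr hz.1), hq.zero, sub_zero]

theorem exists_isThreefoldPair {Δ : ℝ} (hu : IsUtility u) (hT : IsWeighting T)
    (hq : IsLossQuantile q M) (hAP : RiskAversionCondition u T q W) (hMW : M ≤ W) (hWw : W < w)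
    (hΔ : 0 < Δ) (hΔK : Δ < threshold u T q w) :
    ∃ z₂ z₁ : ℝ, IsThreefoldPair u T q w Δ z₂ z₁ := by
  have ha := hT.pointA_mem
  have hc := hT.pointC_spec.1
  have hMw : M < w := hMW.trans_lt hWw
  choose! ζ hζ hζ0 using fun z₂ (h2 : z₂ ∈ Icc 0 (pointA T)) =>
    exists_gap_eq_zero hu hT hq hAP hMW hWw h2
  have hζ1 : ∀ z ∈ Icc 0 (pointA T), ζ z < 1 := fun z hz => (hζ z hz).2.trans_lt hc.2
  have hζI : ∀ z ∈ Icc 0 (pointA T), ζ z ∈ Ico (pointA T) 1 := fun z hz =>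
    ⟨(hζ z hz).1, hζ1 z hz⟩
  have hgapc : ∀ x ∈ Ico (pointA T) 1,
      ContinuousOn (fun z => gap u T q w z x) (Icc 0 (pointA T)) := fun x hx =>
    continuousOn_gap hu hT hq hMw continuousOn_id continuousOn_const
      (fun z hz => hz.1) (fun z hz => hz.2.trans hx.1) (fun _ _ => hx.2)
  -- Implicit function argument without derivatives: strict sign of the gap at a fixed `x` beside `ζ
  -- z₀` persists for nearby `z`, and strict monotonicity in `z₁` keeps `ζ z` on the same side of
  -- `x`.
  have hζc : ContinuousOn ζ (Icc 0 (pointA T)) := by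
    intro z₀ hz₀
    refine tendsto_order.mpr ⟨fun x hx => ?_, fun y hy => ?_⟩
    · rcases lt_or_ge x (pointA T) with hxa | hxa
      · filter_upwards [self_mem_nhdsWithin] with z hz
        exact hxa.trans_le (hζ z hz).1
      have hxI : x ∈ Ico (pointA T) 1 := ⟨hxa, hx.trans (hζ1 z₀ hz₀)⟩
      have hneg : gap u T q w z₀ x < 0 :=
        hζ0 z₀ hz₀ ▸ gap_strictMonoOn hu hT hq hMw hz₀ hxI (hζI z₀ hz₀) hx
      filter_upwards [self_mem_nhdsWithin, (hgapc x hxI z₀ hz₀).eventually (gt_mem_nhds hneg)]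
        with z hz hzx
      rw [← hζ0 z hz] at hzx
      exact ((gap_strictMonoOn hu hT hq hMw hz).lt_iff_lt hxI (hζI z hz)).mp hzx
    · rcases le_or_gt 1 y with hy1 | hy1
      · filter_upwards [self_mem_nhdsWithin] with z hz
        exact (hζ1 z hz).trans_le hy1
      have hyI : y ∈ Ico (pointA T) 1 := ⟨(hζ z₀ hz₀).1.trans hy.le, hy1⟩
      have hpos : 0 < gap u T q w z₀ y :=
        hζ0 z₀ hz₀ ▸ gap_strictMonoOn hu hT hq hMw hz₀ (hζI z₀ hz₀) hyI hy
      filter_upwards [self_mem_nhdsWithin, (hgapc y hyI z₀ hz₀).eventually (lt_mem_nhds hpos)]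
        with z hz hzy
      rw [← hζ0 z hz] at hzy
      exact ((gap_strictMonoOn hu hT hq hMw hz).lt_iff_lt (hζI z hz) hyI).mp hzy
  have hmc : ContinuousOn (fun z => ∫ t in (0 : ℝ)..1, threefold q z (ζ z) t)
      (Icc 0 (pointA T)) := by
    have h := continuousOn_integral_layer (φ := fun x => x) (k := fun _ => 1) hq continuousOn_id
      intervalIntegrable_const continuousOn_id hζc
      (fun z hz => ⟨hz.1, hz.2.trans ha.2.le⟩)
      (fun z hz => ⟨hz.1.trans (hz.2.trans (hζ z hz).1), (hζ1 z hz).le⟩)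
      (fun z hz => hz.2.trans (hζ z hz).1)
    refine h.congr fun z hz => integral_congr_Icc fun t ht => ?_
    rw [threefold_eq_layer hq hz.1 (hz.2.trans (hζ z hz).1) (hζ1 z hz).le ht]
    simp only [id, mul_one]
  have h0m : (0 : ℝ) ∈ Icc 0 (pointA T) := ⟨le_rfl, ha.1.le⟩
  have ham : pointA T ∈ Icc 0 (pointA T) := ⟨ha.1.le, le_rfl⟩
  have hL := pointL_spec hu hT hq hAP hMW hWw
  -- At `z₂ = 0` the gap is `h_Δ`, and strict monotonicity allows only one zero; so the contract
  -- there has mean `K_Δ`.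
  have hζzero : ζ 0 = pointL u T q w := by
    refine (gap_strictMonoOn hu hT hq hMw h0m).injOn (hζI 0 h0m)
      ⟨hL.1.1.le, hL.1.2.trans_lt hc.2⟩ ?_
    rw [hζ0 0 h0m, ← hFun_eq_gap hq, hL.2]
  have hζa : ζ (pointA T) = pointA T := by
    refine (gap_strictMonoOn hu hT hq hMw ham).injOn (hζI _ ham) ⟨le_rfl, ha.2⟩ ?_
    rw [hζ0 _ ham]
    simp [gap]
  have hend : ∫ t in (0 : ℝ)..1, threefold q (pointA T) (ζ (pointA T)) t = 0 := by
    have : ∀ t, threefold q (pointA T) (pointA T) t = 0 := fun t => by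
      simp only [threefold, sub_self]
      split_ifs <;> rfl
    simp [hζa, this]
  obtain ⟨z, hz, hzΔ⟩ := intermediate_value_Icc' ha.1.le hmc (a := 0) (b := pointA T)
    (show Δ ∈ Icc _ _ by
      rw [hend, hζzero, ← threshold_eq hq]
      exact ⟨hΔ.le, hΔK.le⟩)
  exact ⟨z, ζ z, hz.1, hz.2, (hζ z hz).1, hζ1 z hz, hζ0 z hz, hzΔ⟩

end Existence

end

end RDUInsurance

/-! ### The theorem -/

theorem mainTheorem6 {Ω : Type*} [MeasurableSpace Ω] (P : MeasureTheory.Measure Ω)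
    [MeasureTheory.IsProbabilityMeasure P] (X : Ω → ℝ) (M : ℝ)
    (hX : RDUInsurance.IsLoss P X M)
    (u T : ℝ → ℝ) (hu : RDUInsurance.IsUtility u) (hT : RDUInsurance.IsWeighting T)
    (W₀ ρ W Δ WΔ : ℝ) (hρ : -1 < ρ)
    (hW : W = W₀ - (1 + ρ) * ∫ ω, X ω ∂P)
    (hWM : 0 ≤ W - M)
    (hWΔ : WΔ = W + (1 + ρ) * Δ)
    (hAP : RDUInsurance.RiskAversionCondition u T (RDUInsurance.quantile P X) W)
    (hΔ : 0 < Δ)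
    (hΔK : Δ < RDUInsurance.threshold u T (RDUInsurance.quantile P X) WΔ) :
    (∃ z₂ z₁ : ℝ,
      RDUInsurance.IsThreefoldPair u T (RDUInsurance.quantile P X) WΔ Δ z₂ z₁) ∧
    ∀ z₂ z₁ : ℝ,
      RDUInsurance.IsThreefoldPair u T (RDUInsurance.quantile P X) WΔ Δ z₂ z₁ →
      ∀ G : ℝ → ℝ, RDUInsurance.IsOptimal P X M u T WΔ Δ G ↔
        Set.EqOn G (RDUInsurance.threefold (RDUInsurance.quantile P X) z₂ z₁)
          (Set.Icc 0 1) := by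
  open RDUInsurance in
  have hq := hX.isLossQuantile
  have hMW : M ≤ W := sub_nonneg.mp hWM
  have hWw : W < WΔ := by
    rw [hWΔ]
    have : 0 < (1 + ρ) * Δ := mul_pos (by linarith) hΔ
    linarith
  refine ⟨exists_isThreefoldPair hu hT hq hAP hMW hWw hΔ hΔK, fun z₂ z₁ hz G => ?_⟩
  have h21 : z₂ ≤ z₁ := hz.le_a.trans hz.a_le
  have hz1 : z₁ ∈ Icc (0 : ℝ) 1 := ⟨hz.nonneg.trans h21, hz.lt_one.le⟩
  have hz2 : z₂ ∈ Icc (0 : ℝ) 1 := ⟨hz.nonneg, h21.trans hz.lt_one.le⟩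
  have hfeas : ∀ H : ℝ → ℝ, EqOn H (threefold (quantile P X) z₂ z₁) (Icc 0 1) →
      H ∈ feasibleSet P X M Δ := fun H hH =>
    ⟨hX.mem_retentionQuantiles_iff.mpr ⟨layer (quantile P X z₂) (quantile P X z₁),
      layer_mem_retentions (hq.nonneg hz2) (hq.mono hz2 hz1 h21),
      hH.trans (threefold_eq_layer hq hz.nonneg h21 hz.lt_one.le)⟩,
      (hz.mean_eq.symm.trans (integral_congr_Icc hH).symm).le⟩
  -- Gives both directions: an optimal `G` does at least as well as the contract, hence equals it; a
  -- strictly better `H` would equal it too, which is absurd.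
  have hbest : ∀ H ∈ feasibleSet P X M Δ,
      objective u T WΔ (threefold (quantile P X) z₂ z₁) ≤ objective u T WΔ H →
      EqOn H (threefold (quantile P X) z₂ z₁) (Icc 0 1) := by
    rintro H ⟨hH, hmean⟩ hobj
    obtain ⟨R, hR, hHR⟩ := hX.mem_retentionQuantiles_iff.mp hH
    rw [integral_congr_Icc hHR] at hmean
    rw [objective_congr hHR] at hobj
    exact hHR.trans (hz.eqOn_of_objective_le hu hT hq hAP hMW hWw hΔ hR hmean hobj)
  constructor
  · rintro ⟨hG, hmax⟩
    exact hbest G hG (hmax (hfeas _ (eqOn_refl _ _)))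
  · intro hG
    refine ⟨hfeas G hG, fun H hH => ?_⟩
    change objective u T WΔ H ≤ objective u T WΔ G
    rw [objective_congr hG]
    by_contra! hlt
    exact hlt.ne' (objective_congr (hbest H hH hlt.le))
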